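/- Let $n\ge 2$, let $\mathbb T=[0,1)^n$ be the flat torus, $\mathcal C^\infty_\#$ the space of smooth complex functions on $\mathbb R^n$ that are $1$-periodic in each variable, and $\mathcal D'_\#$ its dual, the space of periodic (torus) distributions. Smooth periodic functions are identified with the distributions $\psi\mapsto\int_{\mathbb T}\varphi\psi\,dx$. For $g\in\mathcal D'_\#$ put $\hat g(\xi)=\langle g,e^{-2\pi i x\cdot\xi}\rangle$, $\xi\in\mathbb Z^n$, and let $\rho(\xi)=(1+|\xi|^2)^{1/2}$. For $s\in\mathbb R$ let $H^s_\#=\{g\in\mathcal D'_\#:\sum_{\xi\in\mathbb Z^n}\rho(\xi)^{2s}|\hat g(\xi)|^2<\infty\}$, $\dot H^s_\#=\{g\in H^s_\#:\langle g,1\rangle=0\}$, $\dot{\mathcal C}^\infty_\#=\{g\in\mathcal C^\infty_\#:\langle g,1\rangle=0\}$, $\dot{\mathbf H}^s_\#=(\dot H^s_\#)^n$, $\dot{\mathbf C}^\infty_\#=(\dot{\mathcal C}^\infty_\#)^n$, and $\dot{\mathbf H}^s_{\#\sigma}=\{\mathbf w\in\dot{\mathbf H}^s_\#:\operatorname{div}\mathbf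 w=0\}$. Let $a_{kj}^{\alpha\beta}$ $(1\le k,j,\alpha,\beta\le n)$ be real constants with $a_{kj}^{\alpha\beta}=a_{\alpha j}^{k\beta}=a_{k\beta}^{\alpha j}$ that satisfy the relaxed ellipticity condition: there is a constant $C_{\mathbb A}>0$ such that $$C_{\mathbb A}\sum_{k,j,\alpha,\beta}a_{kj}^{\alpha\beta}\zeta_{k\alpha}\zeta_{j\beta}\ \ge\ \sum_{k,\alpha}\zeta_{k\alpha}^2$$ for all real symmetric $n\times n$ matrices $\zeta$ with zero trace. Let $(\mathfrak L\mathbf u)_k=\sum_{\alpha,j,\beta}\partial_\alpha\big(a_{kj}^{\alpha\beta}E_{j\beta}(\mathbf u)\big)$ with $E_{j\beta}(\mathbf u)=\tfrac12(\partial_ju_\beta+\partial_\beta u_j)$. Consider the anisotropic incompressible stationary Navier–Stokes equation $$-\mathfrak L\mathbf u+\nabla p+(\mathbf u\cdot\nabla)\mathbf u=\mathbf f$$ in the sense of periodic distributions, where $(\mathbf u\cdot\nabla)\mathbf u=\lim_{m\to\infty}(\mathbf u_m\cdot\nabla)\mathbf u_m$ in $\mathcal D'_\#$ with the Fourier partial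 sums $\mathbf u_m(x)=\sum_{|\xi|\le m}\hat{\mathbf u}(\xi)e^{2\pi i x\cdot\xi}$. Let $s_1>-1+n/2$ and let $(\mathbf u,p)\in\dot{\mathbf H}^{s_1}_{\#\sigma}\times\dot H^{s_1-1}_\#$ be a solution of this equation with right-hand side $\mathbf f\in(\mathcal D'_\#)^n$. (i) If $\mathbf f\in\dot{\mathbf H}^{s_2-2}_\#$ for some $s_2>s_1$, then $(\mathbf u,p)\in\dot{\mathbf H}^{s_2}_{\#\sigma}\times\dot H^{s_2-1}_\#$. (ii) If $\mathbf f\in\dot{\mathbf C}^\infty_\#$, then $(\mathbf u,p)\in\dot{\mathbf C}^\infty_\#\times\dot{\mathcal C}^\infty_\#$. -/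

import Mathlib

open scoped ContDiff

noncomputable section

namespace TorusNS

/-- Smooth periodic (1-periodic in each variable) complex functions on `ℝⁿ`, that is, the smooth
functions on the flat torus, as an algebra under pointwise operations.  (The choice of norm on
`ℝⁿ` plays no role for smoothness.) -/
def CInf (n : ℕ) : Subalgebra ℂ ((Fin n → ℝ) → ℂ) where
  carrier := {φ | ContDiff ℝ ∞ φ ∧
    ∀ (ξ : Fin n → ℤ) (x : Fin n → ℝ), φ (x + fun j => (ξ j : ℝ)) = φ x}
  mul_mem' := fun ha hb => ⟨ha.1.mul hb.1, fun ξ x => by simp [ha.2 ξ x, hb.2 ξ x]⟩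
  add_mem' := fun ha hb => ⟨ha.1.add hb.1, fun ξ x => by simp [ha.2 ξ x, hb.2 ξ x]⟩
  algebraMap_mem' := fun _ => ⟨contDiff_const, fun _ _ => rfl⟩

variable {n : ℕ}

/-- The partial derivative `∂_j` of a smooth periodic function. -/
def smoothDeriv (j : Fin n) : CInf n →ₗ[ℂ] CInf n where
  toFun φ := ⟨fun x => fderiv ℝ φ.1 x (Pi.single j 1), by
    refine ⟨(φ.2.1.fderiv_right (m := ∞) (by simp)).clm_apply contDiff_const, fun ξ x => ?_⟩
    have h : (fun y => φ.1 (y + fun j => (ξ j : ℝ))) = φ.1 := funext (φ.2.2 ξ)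
    have h2 := fderiv_comp_add_right (𝕜 := ℝ) (f := φ.1) (x := x) (fun j => (ξ j : ℝ))
    rw [h] at h2
    change fderiv ℝ φ.1 (x + fun j => (ξ j : ℝ)) _ = fderiv ℝ φ.1 x _
    rw [h2]⟩
  map_add' φ ψ := by
    ext x
    have h1 : DifferentiableAt ℝ φ.1 x := (φ.2.1.differentiable (by simp)).differentiableAt
    have h2 : DifferentiableAt ℝ ψ.1 x := (ψ.2.1.differentiable (by simp)).differentiableAt
    simp [fderiv_add h1 h2]
  map_smul' c φ := by
    ext x
    have h1 : DifferentiableAt ℝ φ.1 x := (φ.2.1.differentiable (by simp)).differentiableAt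
    simp [fderiv_const_smul h1 c]

/-- The exponential `e_ξ(x) = exp (2πi x·ξ)`, `ξ ∈ ℤⁿ`. -/
def expo (ξ : Fin n → ℤ) : CInf n :=
  ⟨fun x => Complex.exp (2 * Real.pi * Complex.I * ∑ j, (x j : ℂ) * (ξ j : ℂ)), by
    refine ⟨?_, fun η x => ?_⟩
    · refine Complex.contDiff_exp.comp (contDiff_const.mul (ContDiff.sum fun j _ => ?_))
      exact (Complex.ofRealCLM.contDiff.comp (contDiff_apply ℝ ℝ j)).mul contDiff_const
    · have h : (2 * Real.pi * Complex.I *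
            ∑ j, (((x + fun j => (η j : ℝ)) j : ℝ) : ℂ) * (ξ j : ℂ)) =
          2 * Real.pi * Complex.I * ∑ j, (x j : ℂ) * (ξ j : ℂ) +
            ((∑ j, η j * ξ j : ℤ) : ℂ) * (2 * Real.pi * Complex.I) := by
        simp only [Pi.add_apply, Complex.ofReal_add, Complex.ofReal_intCast, add_mul,
          Finset.sum_add_distrib, mul_add, Int.cast_sum, Int.cast_mul]
        ring
      change Complex.exp _ = Complex.exp _
      rw [h, Complex.exp_add, Complex.exp_int_mul_two_pi_mul_I, mul_one]⟩

/-- Torus distributions: linear functionals `g` on the smooth periodic functions that are bounded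
with respect to finitely many of the seminorms `sup_x ‖D^k φ(x)‖` (i.e. continuous). -/
def Distr (n : ℕ) : Submodule ℂ (Module.Dual ℂ (CInf n)) where
  carrier := {g | ∃ (m : ℕ) (C : ℝ), ∀ (φ : CInf n) (M : ℝ),
    (∀ k ≤ m, ∀ x, ‖iteratedFDeriv ℝ k φ.1 x‖ ≤ M) → ‖g φ‖ ≤ C * M}
  zero_mem' := ⟨0, 0, fun φ M _ => by simp⟩
  add_mem' := by
    rintro g h ⟨m₁, C₁, h₁⟩ ⟨m₂, C₂, h₂⟩
    refine ⟨max m₁ m₂, C₁ + C₂, fun φ M hM => ?_⟩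
    have e₁ := h₁ φ M fun k hk => hM k (hk.trans (le_max_left _ _))
    have e₂ := h₂ φ M fun k hk => hM k (hk.trans (le_max_right _ _))
    calc ‖(g + h) φ‖ ≤ ‖g φ‖ + ‖h φ‖ := norm_add_le _ _
      _ ≤ (C₁ + C₂) * M := by linarith
  smul_mem' := by
    rintro c g ⟨m, C, h⟩
    refine ⟨m, ‖c‖ * C, fun φ M hM => ?_⟩
    have e := mul_le_mul_of_nonneg_left (h φ M hM) (norm_nonneg c)
    calc ‖(c • g) φ‖ = ‖c‖ * ‖g φ‖ := norm_mul _ _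
      _ ≤ ‖c‖ * C * M := by linarith

/-- The distributional derivative, `⟨∂_j g, φ⟩ = -⟨g, ∂_j φ⟩`. -/
def distDeriv (j : Fin n) : Distr n →ₗ[ℂ] Distr n where
  toFun g := ⟨-(g.1 ∘ₗ smoothDeriv j), by
    obtain ⟨m, C, h⟩ := g.2
    refine ⟨m + 1, C, fun φ M hM => ?_⟩
    rw [LinearMap.neg_apply, norm_neg, LinearMap.comp_apply]
    refine h _ M fun k hk x => ?_
    have hc : ContDiffAt ℝ k (fderiv ℝ φ.1) x :=
      ((φ.2.1.fderiv_right (m := ∞) (by simp)).contDiffAt).of_le (by exact_mod_cast le_top)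
    have h1 : ‖iteratedFDeriv ℝ k (fun y => fderiv ℝ φ.1 y (Pi.single j 1)) x‖ ≤
        ‖(Pi.single j 1 : Fin n → ℝ)‖ * ‖iteratedFDeriv ℝ k (fderiv ℝ φ.1) x‖ :=
      norm_iteratedFDeriv_clm_apply_const hc le_rfl
    have h2 : ‖(Pi.single j 1 : Fin n → ℝ)‖ = 1 := by rw [Pi.norm_single, norm_one]
    rw [h2, one_mul, norm_iteratedFDeriv_fderiv] at h1
    exact h1.trans (hM (k + 1) (by omega) x)⟩
  map_add' g h := Subtype.ext <| LinearMap.ext fun φ => neg_add _ _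
  map_smul' c g := Subtype.ext <| LinearMap.ext fun φ => (mul_neg _ _).symm

/-- The half-open unit cube `[0,1)ⁿ` parametrising the torus. -/
def cube (n : ℕ) : Set (Fin n → ℝ) := Set.univ.pi fun _ => Set.Ico 0 1

/-- Products of smooth periodic functions are integrable over the unit cube. -/
theorem integrableOn_mul (φ ψ : CInf n) :
    MeasureTheory.IntegrableOn (fun x => φ.1 x * ψ.1 x) (cube n) := by
  have hc : Continuous fun x => φ.1 x * ψ.1 x := φ.2.1.continuous.mul ψ.2.1.continuous
  refine (hc.integrableOn_Icc (a := 0) (b := 1)).mono_set fun x hx => ?_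
  have h : ∀ i, x i ∈ Set.Ico (0 : ℝ) 1 := fun i => hx i (Set.mem_univ i)
  exact ⟨fun i => (h i).1, fun i => (h i).2.le⟩

/-- A smooth periodic function `φ` as the distribution `ψ ↦ ∫_{[0,1)ⁿ} φ ψ`. -/
def ofSmooth : CInf n →ₗ[ℂ] Distr n where
  toFun φ :=
    ⟨{ toFun := fun ψ => ∫ x in cube n, φ.1 x * ψ.1 x
       map_add' := fun ψ χ => by
        rw [← MeasureTheory.integral_add (integrableOn_mul φ ψ) (integrableOn_mul φ χ)]
        simp [mul_add]
       map_smul' := fun c ψ => by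
        rw [RingHom.id_apply, ← MeasureTheory.integral_smul]
        simp [mul_left_comm] }, by
    refine ⟨0, ∫ x in cube n, ‖φ.1 x‖, fun ψ M hM => ?_⟩
    have hM' : ∀ x, ‖ψ.1 x‖ ≤ M := fun x => by simpa using hM 0 le_rfl x
    rw [← MeasureTheory.integral_mul_const]
    have hi : MeasureTheory.IntegrableOn (fun x => φ.1 x) (cube n) := by
      simpa using integrableOn_mul φ 1
    refine MeasureTheory.norm_integral_le_of_norm_le (hi.norm.mul_const M)
      (Filter.Eventually.of_forall fun x => ?_)
    rw [norm_mul]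
    exact mul_le_mul_of_nonneg_left (hM' x) (norm_nonneg _)⟩
  map_add' φ χ := by
    ext ψ
    simp only [LinearMap.coe_mk, AddHom.coe_mk, Submodule.coe_add, LinearMap.add_apply]
    rw [← MeasureTheory.integral_add (integrableOn_mul φ ψ) (integrableOn_mul χ ψ)]
    simp [add_mul]
  map_smul' c φ := by
    ext ψ
    simp only [LinearMap.coe_mk, AddHom.coe_mk, Submodule.coe_smul, LinearMap.smul_apply,
      RingHom.id_apply]
    rw [← MeasureTheory.integral_smul]
    simp [mul_assoc]

/-- The Fourier coefficient `ĝ(ξ) = ⟨g, e^{-2πi x·ξ}⟩`. -/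
def fourierCoeff (g : Distr n) (ξ : Fin n → ℤ) : ℂ := g.1 (expo (-ξ))

/-- `ρ(ξ) = (1 + |ξ|²)^{1/2}`, with the Euclidean norm `|ξ|`. -/
def rho (ξ : Fin n → ℤ) : ℝ := Real.sqrt (1 + ∑ j, (ξ j : ℝ) ^ 2)

/-- The periodic Sobolev (Bessel-potential) space `H^s_#`, `s ∈ ℝ`. -/
def HSob (n : ℕ) (s : ℝ) : Set (Distr n) :=
  {g | Summable fun ξ : Fin n → ℤ => rho ξ ^ (2 * s) * ‖fourierCoeff g ξ‖ ^ 2}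

/-- The space `Ḣ^s_#` of `g ∈ H^s_#` with zero mean, `⟨g, 1⟩ = 0`. -/
def HDot (n : ℕ) (s : ℝ) : Set (Distr n) := {g | g ∈ HSob n s ∧ g.1 1 = 0}

/-- The divergence of a vector distribution. -/
def divergence (u : Fin n → Distr n) : Distr n := ∑ j, distDeriv j (u j)

/-- The space `Ḣ^s_{#σ}` of divergence-free vector distributions with components in `Ḣ^s_#`. -/
def HDotSigma (n : ℕ) (s : ℝ) : Set (Fin n → Distr n) :=
  {u | (∀ j, u j ∈ HDot n s) ∧ divergence u = 0}

/-- The distributions given by smooth periodic functions with zero mean, `Ċ^∞_#`. -/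
def CInfDot (n : ℕ) : Set (Distr n) := {g | (∃ φ : CInf n, g = ofSmooth φ) ∧ g.1 1 = 0}

/-- The symmetry conditions `a_{kj}^{αβ} = a_{αj}^{kβ} = a_{kβ}^{αj}`; here and below `a k j α β`
stands for `a_{kj}^{αβ}`. -/
def IsSymmTensor (a : Fin n → Fin n → Fin n → Fin n → ℝ) : Prop :=
  ∀ k j α β, a k j α β = a α j k β ∧ a k j α β = a k β α j

/-- The relaxed ellipticity condition: `C a_{kj}^{αβ} ζ_{kα} ζ_{jβ} ≥ |ζ|²` for all symmetric real
matrices `ζ` with zero trace. -/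
def IsRelaxedElliptic (a : Fin n → Fin n → Fin n → Fin n → ℝ) : Prop :=
  ∃ C : ℝ, 0 < C ∧ ∀ ζ : Matrix (Fin n) (Fin n) ℝ, ζ.IsSymm → ζ.trace = 0 →
    ∑ k, ∑ α, ζ k α ^ 2 ≤ C * ∑ k, ∑ j, ∑ α, ∑ β, a k j α β * ζ k α * ζ j β

/-- `E_{jβ}(u) = (∂_j u_β + ∂_β u_j) / 2`. -/
def strain (u : Fin n → Distr n) (j β : Fin n) : Distr n :=
  (1 / 2 : ℂ) • (distDeriv j (u β) + distDeriv β (u j))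

/-- `(𝔏u)_k = ∂_α (a_{kj}^{αβ} E_{jβ}(u))`. -/
def viscousOp (a : Fin n → Fin n → Fin n → Fin n → ℝ) (u : Fin n → Distr n) (k : Fin n) :
    Distr n :=
  ∑ α, distDeriv α (∑ j, ∑ β, (a k j α β : ℂ) • strain u j β)

/-- The integer points `ξ` with `|ξ| ≤ m`. -/
def latticeBall (n m : ℕ) : Finset (Fin n → ℤ) :=
  (Finset.Icc (fun _ => -(m : ℤ)) (fun _ => (m : ℤ))).filter
    fun ξ => ∑ j, ξ j ^ 2 ≤ (m : ℤ) ^ 2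

/-- The Fourier partial sum `g_m = ∑_{|ξ| ≤ m} ĝ(ξ) e^{2πi x·ξ}`. -/
def partialSum (m : ℕ) (g : Distr n) : CInf n :=
  ∑ ξ ∈ latticeBall n m, fourierCoeff g ξ • expo ξ

/-- `((v·∇)v)_k = v_j ∂_j v_k` for smooth periodic `v`. -/
def smoothAdvection (v : Fin n → CInf n) (k : Fin n) : CInf n :=
  ∑ j, v j * smoothDeriv j (v k)

/-- `B` is the advection term `(u·∇)u` of the vector distribution `u`: the product of
distributions is understood as the limit, in the sense of distributions, of the products of the
Fourier partial sums, `(u·∇)u = lim_{m → ∞} (u_m·∇)u_m`. -/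
def IsAdvection (u B : Fin n → Distr n) : Prop :=
  ∀ (k : Fin n) (φ : CInf n), Filter.Tendsto
    (fun m : ℕ => (ofSmooth (smoothAdvection (fun j => partialSum m (u j)) k)).1 φ)
    Filter.atTop (nhds ((B k).1 φ))

/-- `(u, p)` satisfies `-𝔏u + ∇p + (u·∇)u = f` in the sense of distributions (the
incompressibility `div u = 0` is part of the space to which `u` belongs). -/
def IsNavierStokesSolution (a : Fin n → Fin n → Fin n → Fin n → ℝ) (u : Fin n → Distr n)
    (p : Distr n) (f : Fin n → Distr n) : Prop :=
  ∃ B : Fin n → Distr n, IsAdvection u B ∧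
    ∀ k, -viscousOp a u k + distDeriv k p + B k = f k

end TorusNS

end

open scoped ContDiff

noncomputable section

namespace TorusNS

variable {n : ℕ}

/-! On the Fourier side the equation reads, at each frequency ξ, as a Stokes system `4π² A(ξ) û(ξ) +
2πi ξ p̂(ξ) = f̂(ξ) - B̂(ξ)` with `ξ · û(ξ) = 0`, where B is the advection term. Regularity follows
from a linear gain of two derivatives, a nonlinear loss of strictly less than two, and iteration.

Linear part (`exists_stokes_bound`). Relaxed ellipticity is tested on the symmetric part of `ξ ⊗ w`,
which is traceless exactly when `ξ · w = 0`; this makes `A(ξ)` coercive of size `|ξ|²` on the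
divergence-free directions. Pairing the system with the conjugate of `û` removes the pressure and
bounds `ρ² |û|`; pairing it with ξ then bounds `ρ |p̂|`. The frequency 0 is excluded by the zero
means.

Nonlinear part (`WeightedL2.convolution`, `norm_fourierCoeff_advection_le`). Since `div u = 0`, the
derivative in `(u·∇)u` can be moved in front of the product, so that `B̂(ξ)` is at most `2π ρ(ξ)`
times a convolution of `|û|` with itself. For `0 < s ≤ σ` and `σ > n/2` the product maps `H^s × H^s`
to `H^(2s-σ)`. With `σ = s + 1 - ε` the advection term is in `H^(s-2+ε)`, and the Stokes estimate
returns `u ∈ H^(s+ε)`, as long as f permits.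

The condition `s₁ > -1 + n/2` leaves room for one `ε > 0` that serves for all `s ≥ s₁`, so finitely
many steps (`regularity_step`) reach `s₂`. In the smooth case all Sobolev orders are reached, the
Fourier coefficients decay rapidly, and a distribution with such coefficients is a smooth function
(`eq_ofSmooth_of_rapidDecay`). -/

/-! ### Exponentials and Fourier coefficients of torus distributions -/

theorem expo_apply (ξ : Fin n → ℤ) (x : Fin n → ℝ) :
    (expo ξ).1 x = Complex.exp (2 * Real.pi * Complex.I * ∑ j, (x j : ℂ) * (ξ j : ℂ)) := rfl

theorem expo_add (ξ η : Fin n → ℤ) : expo (ξ + η) = expo ξ * expo η := by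
  ext x
  change (expo (ξ + η)).1 x = (expo ξ).1 x * (expo η).1 x
  simp only [expo_apply, ← Complex.exp_add, ← mul_add, ← Finset.sum_add_distrib, Pi.add_apply,
    Int.cast_add]

theorem expo_zero : expo (0 : Fin n → ℤ) = 1 := by
  ext x
  change (expo 0).1 x = 1
  simp [expo_apply]

theorem hasFDerivAt_expo (ξ : Fin n → ℤ) (x : Fin n → ℝ) :
    HasFDerivAt (expo ξ).1 ((expo ξ).1 x • ((2 * Real.pi * Complex.I : ℂ) •
      ∑ j, (ξ j : ℂ) • (Complex.ofRealCLM.comp (ContinuousLinearMap.proj (R := ℝ)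
        (φ := fun _ : Fin n => ℝ) j)))) x := by
  have h : HasFDerivAt (fun y : Fin n → ℝ => ∑ j, (y j : ℂ) * (ξ j : ℂ))
      (∑ j, (ξ j : ℂ) • (Complex.ofRealCLM.comp (ContinuousLinearMap.proj (R := ℝ)
        (φ := fun _ : Fin n => ℝ) j))) x := by
    refine HasFDerivAt.fun_sum fun j _ => ?_
    exact (Complex.ofRealCLM.comp (ContinuousLinearMap.proj (R := ℝ)
        (φ := fun _ : Fin n => ℝ) j)).hasFDerivAt.mul_const' (ξ j : ℂ) |>.congr_fderiv (by
          ext; simp [mul_comm])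
  exact (h.const_mul (2 * Real.pi * Complex.I : ℂ)).cexp

theorem smoothDeriv_expo (j : Fin n) (ξ : Fin n → ℤ) :
    smoothDeriv j (expo ξ) = (2 * Real.pi * Complex.I * (ξ j : ℂ)) • expo ξ := by
  ext x
  change fderiv ℝ (expo ξ).1 x (Pi.single j 1) = (2 * Real.pi * Complex.I * (ξ j : ℂ)) * (expo ξ).1 x
  rw [(hasFDerivAt_expo ξ x).fderiv]
  have : ∑ i, (ξ i : ℂ) * ((Pi.single j (1:ℝ) : Fin n → ℝ) i : ℂ) = ξ j := by
    rw [Finset.sum_eq_single j] <;> simp +contextual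
  simp [this]
  ring

theorem smoothDeriv_mul (j : Fin n) (φ ψ : CInf n) :
    smoothDeriv j (φ * ψ) = φ * smoothDeriv j ψ + smoothDeriv j φ * ψ := by
  ext x
  have h1 : DifferentiableAt ℝ φ.1 x := (φ.2.1.differentiable (by simp)).differentiableAt
  have h2 : DifferentiableAt ℝ ψ.1 x := (ψ.2.1.differentiable (by simp)).differentiableAt
  change fderiv ℝ (φ.1 * ψ.1) x (Pi.single j 1) = φ.1 x * fderiv ℝ ψ.1 x (Pi.single j 1) +
    fderiv ℝ φ.1 x (Pi.single j 1) * ψ.1 x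
  rw [fderiv_mul h1 h2]
  simp [mul_comm]

theorem fourierCoeff_add (g h : Distr n) (ξ : Fin n → ℤ) :
    fourierCoeff (g + h) ξ = fourierCoeff g ξ + fourierCoeff h ξ := rfl

theorem fourierCoeff_neg (g : Distr n) (ξ : Fin n → ℤ) :
    fourierCoeff (-g) ξ = -fourierCoeff g ξ := rfl

theorem fourierCoeff_smul (c : ℂ) (g : Distr n) (ξ : Fin n → ℤ) :
    fourierCoeff (c • g) ξ = c * fourierCoeff g ξ := rfl

theorem fourierCoeff_sum {ι : Type*} (s : Finset ι) (g : ι → Distr n) (ξ : Fin n → ℤ) :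
    fourierCoeff (∑ i ∈ s, g i) ξ = ∑ i ∈ s, fourierCoeff (g i) ξ := by
  simp [fourierCoeff, LinearMap.sum_apply]

theorem fourierCoeff_distDeriv (j : Fin n) (g : Distr n) (ξ : Fin n → ℤ) :
    fourierCoeff (distDeriv j g) ξ = 2 * Real.pi * Complex.I * (ξ j : ℂ) * fourierCoeff g ξ := by
  change -(g.1 (smoothDeriv j (expo (-ξ)))) = _ * g.1 (expo (-ξ))
  rw [smoothDeriv_expo, map_smul]
  simp

theorem cube_ae_eq_Icc : cube n =ᵐ[MeasureTheory.volume] Set.Icc (0 : Fin n → ℝ) 1 :=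
  MeasureTheory.Measure.univ_pi_Ico_ae_eq_Icc

theorem cube_ae_eq_Ioc : cube n =ᵐ[MeasureTheory.volume]
    {x : Fin n → ℝ | ∀ i, x i ∈ Set.Ioc ((0 : Fin n → ℝ) i) ((0 : Fin n → ℝ) i + 1)} := by
  have h : {x : Fin n → ℝ | ∀ i, x i ∈ Set.Ioc ((0 : Fin n → ℝ) i) ((0 : Fin n → ℝ) i + 1)} =
      Set.univ.pi fun i => Set.Ioc ((0 : Fin n → ℝ) i) ((1 : Fin n → ℝ) i) := by
    ext x; simp
  rw [h]
  exact cube_ae_eq_Icc.trans MeasureTheory.Measure.univ_pi_Ioc_ae_eq_Icc.symm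

/-- The integral of a partial derivative over a period vanishes. -/
theorem integral_smoothDeriv (j : Fin n) (φ : CInf n) :
    ∫ x in cube n, (smoothDeriv j φ).1 x = 0 := by
  obtain _ | m := n
  · exact j.elim0
  rw [MeasureTheory.setIntegral_congr_set cube_ae_eq_Icc]
  have hd : ∀ x, HasFDerivAt φ.1 (fderiv ℝ φ.1 x) x := fun x =>
    ((φ.2.1.differentiable (by simp)).differentiableAt).hasFDerivAt
  have hs : ∀ x, ∑ i, (if i = j then fderiv ℝ φ.1 x else 0) (Pi.single i 1) =
      (smoothDeriv j φ).1 x := fun x => by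
    rw [Finset.sum_eq_single j] <;> simp +contextual [smoothDeriv]
  -- The divergence theorem on the unit cube, for the field whose only nonzero component is φ in
  -- direction j.
  have key := MeasureTheory.integral_divergence_of_hasFDerivAt_off_countable'
    (0 : Fin (m + 1) → ℝ) 1 zero_le_one (fun i x => if i = j then φ.1 x else 0)
    (fun i x => if i = j then fderiv ℝ φ.1 x else 0) ∅ Set.countable_empty
    (fun i => by
      by_cases h : i = j
      · simpa [h] using φ.2.1.continuous.continuousOn
      · simpa [h] using continuousOn_const)
    (fun x _ i => by
      by_cases h : i = j
      · simpa [h] using hd x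
      · simpa [h] using hasFDerivAt_const (0 : ℂ) x)
    (by
      simp only [hs]
      exact (smoothDeriv j φ).2.1.continuous.integrableOn_Icc)
  simp only [hs] at key
  rw [key]
  refine Finset.sum_eq_zero fun i _ => ?_
  by_cases h : i = j
  · subst h
    -- Periodicity identifies φ on the two opposite faces, so the boundary terms cancel.
    have hper : ∀ x : Fin m → ℝ, φ.1 (i.insertNth (1 : ℝ) x) = φ.1 (i.insertNth (0 : ℝ) x) := by
      intro x
      rw [← φ.2.2 (Pi.single i 1) (i.insertNth (0 : ℝ) x)]
      refine congrArg φ.1 (funext fun k => ?_)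
      refine Fin.succAboveCases i ?_ (fun l => ?_) k
      · simp
      · simp [Fin.succAbove_ne]
    simp [hper]
  · simp [h]

theorem ofSmooth_apply (φ ψ : CInf n) :
    (ofSmooth φ).1 ψ = ∫ x in cube n, φ.1 x * ψ.1 x := rfl

theorem ofSmooth_comm (φ ψ : CInf n) : (ofSmooth φ).1 ψ = (ofSmooth ψ).1 φ := by
  simp only [ofSmooth_apply, mul_comm]

theorem distDeriv_ofSmooth (j : Fin n) (φ : CInf n) :
    distDeriv j (ofSmooth φ) = ofSmooth (smoothDeriv j φ) := by
  refine Subtype.ext (LinearMap.ext fun ψ => ?_)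
  change -((ofSmooth φ).1 (smoothDeriv j ψ)) = (ofSmooth (smoothDeriv j φ)).1 ψ
  have h := integral_smoothDeriv j (φ * ψ)
  rw [smoothDeriv_mul] at h
  have h2 : ∫ x in cube n, (φ.1 x * (smoothDeriv j ψ).1 x + (smoothDeriv j φ).1 x * ψ.1 x) = 0 := h
  rw [MeasureTheory.integral_add (integrableOn_mul _ _) (integrableOn_mul _ _)] at h2
  exact neg_eq_of_add_eq_zero_right h2

theorem fourierCoeff_ofSmooth_smoothDeriv (j : Fin n) (φ : CInf n) (ξ : Fin n → ℤ) :
    fourierCoeff (ofSmooth (smoothDeriv j φ)) ξ =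
      2 * Real.pi * Complex.I * (ξ j : ℂ) * fourierCoeff (ofSmooth φ) ξ := by
  rw [← distDeriv_ofSmooth, fourierCoeff_distDeriv]

theorem volume_cube : (MeasureTheory.volume (cube n)) = 1 := by
  simp [cube, Real.volume_pi_Ico]

/-- If some `ξ j` is nonzero, the exponential is a multiple of its own j-th derivative, whose
integral over a period vanishes. -/
theorem integral_expo (ξ : Fin n → ℤ) :
    ∫ x in cube n, (expo ξ).1 x = if ξ = 0 then 1 else 0 := by
  split_ifs with h
  · subst h
    rw [expo_zero]
    change ∫ x in cube n, (1 : ℂ) = 1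
    simp [MeasureTheory.Measure.real, volume_cube]
  · obtain ⟨j, hj⟩ := Function.ne_iff.1 h
    have h1 := integral_smoothDeriv j (expo ξ)
    rw [smoothDeriv_expo] at h1
    change ∫ x in cube n, (2 * Real.pi * Complex.I * (ξ j : ℂ)) * (expo ξ).1 x = 0 at h1
    rw [MeasureTheory.integral_const_mul] at h1
    refine (mul_eq_zero.1 h1).resolve_left ?_
    have : (ξ j : ℂ) ≠ 0 := by exact_mod_cast hj
    simp [this, Real.pi_ne_zero]

theorem ofSmooth_expo_expo (ξ η : Fin n → ℤ) :
    (ofSmooth (expo ξ)).1 (expo η) = if ξ + η = 0 then 1 else 0 := by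
  rw [← integral_expo, expo_add]
  rfl

theorem norm_expo (ξ : Fin n → ℤ) (x : Fin n → ℝ) : ‖(expo ξ).1 x‖ = 1 := by
  have : (2 * Real.pi * Complex.I * ∑ j, (x j : ℂ) * (ξ j : ℂ)) =
      ((2 * Real.pi * ∑ j, x j * ξ j : ℝ) : ℂ) * Complex.I := by
    push_cast; ring
  rw [expo_apply, this, Complex.norm_exp_ofReal_mul_I]

/-! ### The weight ρ and the decay of Fourier coefficients of smooth functions -/

theorem rho_sq (ξ : Fin n → ℤ) : rho ξ ^ 2 = 1 + ∑ j, (ξ j : ℝ) ^ 2 :=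
  Real.sq_sqrt (by positivity)

theorem one_le_rho (ξ : Fin n → ℤ) : 1 ≤ rho ξ := by
  have : 0 ≤ ∑ j, (ξ j : ℝ) ^ 2 := by positivity
  exact Real.one_le_sqrt.2 (by linarith)

theorem rho_pos (ξ : Fin n → ℤ) : 0 < rho ξ := one_pos.trans_le (one_le_rho ξ)

theorem abs_le_rho (ξ : Fin n → ℤ) (j : Fin n) : |(ξ j : ℝ)| ≤ rho ξ := by
  refine Real.abs_le_sqrt ?_
  have := Finset.single_le_sum (f := fun j => (ξ j : ℝ) ^ 2) (fun i _ => sq_nonneg _)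
    (Finset.mem_univ j)
  linarith

/-- The Bessel operator `1 - Δ / (4π²)`, with symbol `ρ²`. -/
def besselOp (φ : CInf n) : CInf n :=
  φ - (1 / (4 * Real.pi ^ 2) : ℂ) • ∑ j, smoothDeriv j (smoothDeriv j φ)

theorem fourierCoeff_besselOp (φ : CInf n) (ξ : Fin n → ℤ) :
    fourierCoeff (ofSmooth (besselOp φ)) ξ = (rho ξ : ℂ) ^ 2 * fourierCoeff (ofSmooth φ) ξ := by
  have hpi : (Real.pi : ℂ) ≠ 0 := by simp [Real.pi_ne_zero]
  rw [besselOp, sub_eq_add_neg, map_add, map_neg, map_smul, map_sum, fourierCoeff_add,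
    fourierCoeff_neg, fourierCoeff_smul, fourierCoeff_sum]
  simp only [fourierCoeff_ofSmooth_smoothDeriv]
  have hr : (rho ξ : ℂ) ^ 2 = 1 + ∑ j, (ξ j : ℂ) ^ 2 := by
    have h := congrArg (fun r : ℝ => (r : ℂ)) (rho_sq ξ)
    push_cast at h
    exact h
  rw [hr, Finset.mul_sum, ← sub_eq_add_neg, add_mul, one_mul, Finset.sum_mul, sub_eq_add_neg, ← Finset.sum_neg_distrib]
  congr 1
  refine Finset.sum_congr rfl fun j _ => ?_
  field_simp
  rw [Complex.I_sq]
  ring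

theorem norm_fourierCoeff_ofSmooth_le (φ : CInf n) (ξ : Fin n → ℤ) :
    ‖fourierCoeff (ofSmooth φ) ξ‖ ≤ ∫ x in cube n, ‖φ.1 x‖ := by
  refine (MeasureTheory.norm_integral_le_integral_norm _).trans_eq ?_
  simp [norm_expo]

/-- The Fourier coefficients of a smooth function decay rapidly. -/
theorem exists_rho_pow_mul_fourierCoeff_le (φ : CInf n) (N : ℕ) :
    ∃ C : ℝ, ∀ ξ, rho ξ ^ N * ‖fourierCoeff (ofSmooth φ) ξ‖ ≤ C := by
  -- N applications of the Bessel operator multiply the coefficients by `ρ^(2N)`, and the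
  -- coefficients of the resulting smooth function are bounded by its L¹ norm.
  have h : ∀ ξ, rho ξ ^ (2 * N) * ‖fourierCoeff (ofSmooth φ) ξ‖ =
      ‖fourierCoeff (ofSmooth (besselOp^[N] φ)) ξ‖ := by
    intro ξ
    induction N with
    | zero => simp
    | succ N ih =>
      rw [Function.iterate_succ_apply', fourierCoeff_besselOp, norm_mul, ← ih, norm_pow,
        Complex.norm_real, Real.norm_of_nonneg (rho_pos ξ).le]
      ring
  refine ⟨∫ x in cube n, ‖(besselOp^[N] φ).1 x‖, fun ξ => ?_⟩
  refine le_trans ?_ (norm_fourierCoeff_ofSmooth_le _ ξ)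
  rw [← h]
  exact mul_le_mul_of_nonneg_right (pow_le_pow_right₀ (one_le_rho ξ) (by omega)) (norm_nonneg _)

theorem intCast_mem_span (ξ : Fin n → ℤ) :
    (fun j => (ξ j : ℝ)) ∈ Submodule.span ℤ (Set.range (Pi.basisFun ℝ (Fin n))) := by
  have : (fun j => (ξ j : ℝ)) = ∑ j, ξ j • Pi.basisFun ℝ (Fin n) j := by
    ext i
    simp [Finset.sum_apply, Pi.single_apply]
  rw [this]
  exact Submodule.sum_mem _ fun j _ =>
    Submodule.smul_mem _ _ (Submodule.subset_span (Set.mem_range_self j))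

/-- The integer points lie in the lattice spanned by the standard basis, which has rank n; lattice
sums of `‖·‖^r` converge for r below minus the rank. -/
theorem summable_norm_rpow_int (r : ℝ) (hr : r < -(n : ℝ)) :
    Summable fun ξ : Fin n → ℤ => ‖fun j => (ξ j : ℝ)‖ ^ r := by
  have hL : Module.finrank ℤ (Submodule.span ℤ (Set.range (Pi.basisFun ℝ (Fin n)))) = n := by
    rw [ZLattice.rank ℝ, Module.finrank_fin_fun]
  have h := ZLattice.summable_norm_rpow
    (Submodule.span ℤ (Set.range (Pi.basisFun ℝ (Fin n)))) r (by rw [hL]; exact hr)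
  have hinj : Function.Injective fun ξ : Fin n → ℤ =>
      (⟨_, intCast_mem_span ξ⟩ : Submodule.span ℤ (Set.range (Pi.basisFun ℝ (Fin n)))) := by
    intro ξ η h
    have h2 := Subtype.mk.inj h
    exact funext fun j => by exact_mod_cast congrFun h2 j
  exact (h.comp_injective hinj).congr fun ξ => by
    rw [Function.comp_apply, Submodule.coe_norm]

/-- `∑ ρ(ξ)^r < ∞` for `r < -n`. -/
theorem summable_rho_rpow (r : ℝ) (hr : r < -(n : ℝ)) :
    Summable fun ξ : Fin n → ℤ => rho ξ ^ r := by
  -- The extra term covers the frequency 0, where `‖0‖^r = 0` cannot dominate `ρ(0)^r = 1`.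
  have h1 : Summable fun ξ : Fin n → ℤ => if ξ = 0 then (1 : ℝ) else 0 :=
    (hasSum_ite_eq 0 1).summable
  refine Summable.of_nonneg_of_le (fun ξ => (Real.rpow_pos_of_pos (rho_pos ξ) _).le)
    (fun ξ => ?_) ((summable_norm_rpow_int r hr).add h1)
  have hn : (0 : ℝ) ≤ n := n.cast_nonneg
  by_cases h : ξ = 0
  · subst h
    have : rho (0 : Fin n → ℤ) = 1 := by simp [rho]
    rw [this, Real.one_rpow, if_pos rfl]
    exact le_add_of_nonneg_left (by positivity)
  · rw [if_neg h, add_zero]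
    refine Real.rpow_le_rpow_of_nonpos ?_ ?_ (by linarith)
    · rw [norm_pos_iff]
      intro h0
      exact h (funext fun j => by simpa using congrFun h0 j)
    · exact (pi_norm_le_iff_of_nonneg (rho_pos ξ).le).2 fun j => abs_le_rho ξ j

/-- Families of Fourier coefficients that decay faster than any power. -/
def RapidDecay (c : (Fin n → ℤ) → ℂ) : Prop :=
  ∀ N : ℕ, Summable fun ξ => rho ξ ^ N * ‖c ξ‖

theorem rapidDecay_of_bounded {c : (Fin n → ℤ) → ℂ}
    (h : ∀ N : ℕ, ∃ C : ℝ, ∀ ξ, rho ξ ^ N * ‖c ξ‖ ≤ C) : RapidDecay c := by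
  intro N
  -- The n + 1 additional powers of ρ pay for summability, because `∑ ρ^(-(n+1))` converges.
  obtain ⟨C, hC⟩ := h (N + (n + 1))
  have hs := (summable_rho_rpow (n := n) (-(n + 1 : ℕ)) (by push_cast; linarith)).mul_left C
  refine Summable.of_nonneg_of_le (fun ξ => by have := rho_pos ξ; positivity) (fun ξ => ?_) hs
  have hp : 0 < rho ξ ^ (n + 1) := pow_pos (rho_pos ξ) _
  rw [Real.rpow_neg (rho_pos ξ).le, Real.rpow_natCast, ← div_eq_mul_inv, le_div_iff₀ hp]
  calc _ = rho ξ ^ (N + (n + 1)) * ‖c ξ‖ := by ring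
    _ ≤ C := hC ξ

theorem rapidDecay_fourierCoeff_ofSmooth (φ : CInf n) :
    RapidDecay (fourierCoeff (ofSmooth φ)) :=
  rapidDecay_of_bounded (exists_rho_pow_mul_fourierCoeff_le φ)

theorem RapidDecay.mono {c d : (Fin n → ℤ) → ℂ} (hc : RapidDecay c)
    (h : ∀ ξ, ‖d ξ‖ ≤ ‖c ξ‖) : RapidDecay d := fun N =>
  Summable.of_nonneg_of_le (fun ξ => by have := rho_pos ξ; positivity)
    (fun ξ => mul_le_mul_of_nonneg_left (h ξ) (pow_nonneg (rho_pos ξ).le _)) (hc N)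

/-! ### Fourier series with rapidly decaying coefficients -/

theorem iteratedDeriv_exp_two_pi_I (k : ℕ) :
    iteratedDeriv k (fun t : ℝ => Complex.exp (2 * Real.pi * Complex.I * t)) =
      fun t : ℝ => (2 * Real.pi * Complex.I) ^ k * Complex.exp (2 * Real.pi * Complex.I * t) := by
  induction k with
  | zero => simp
  | succ k ih =>
    rw [iteratedDeriv_succ, ih]
    ext t
    have h : HasDerivAt (fun t : ℝ => (2 * Real.pi * Complex.I : ℂ) * t)
        (2 * Real.pi * Complex.I) t := by
      simpa using (Complex.ofRealCLM.hasDerivAt (x := t)).const_mul (2 * Real.pi * Complex.I : ℂ)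
    rw [(h.cexp.const_mul _).deriv]
    ring

/-- The exponential is a function of one real variable composed with the linear form `x ↦ x · ξ`,
whose norm is at most `n ρ(ξ)` for the sup norm on ℝⁿ. The added 1 makes the base at least 1 for
every n, so that the bound increases with k. -/
theorem norm_iteratedFDeriv_expo_le (k : ℕ) (ξ : Fin n → ℤ) (x : Fin n → ℝ) :
    ‖iteratedFDeriv ℝ k (expo ξ).1 x‖ ≤ ((2 * Real.pi * n + 1) * rho ξ) ^ k := by
  let l : (Fin n → ℝ) →L[ℝ] ℝ :=
    ∑ j, (ξ j : ℝ) • ContinuousLinearMap.proj (R := ℝ) (φ := fun _ : Fin n => ℝ) j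
  have hl : ‖l‖ ≤ n * rho ξ := by
    refine ContinuousLinearMap.opNorm_le_bound _ (by have := rho_pos ξ; positivity) fun y => ?_
    have : l y = ∑ j, (ξ j : ℝ) * y j := by simp [l]
    rw [this]
    calc ‖∑ j, (ξ j : ℝ) * y j‖ ≤ ∑ j : Fin n, rho ξ * ‖y‖ := by
          refine norm_sum_le_of_le _ fun j _ => ?_
          rw [norm_mul]
          exact mul_le_mul (abs_le_rho ξ j) (norm_le_pi_norm y j) (norm_nonneg _) (rho_pos ξ).le
      _ = n * rho ξ * ‖y‖ := by simp [mul_assoc]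
  have hf : (expo ξ).1 = (fun t : ℝ => Complex.exp (2 * Real.pi * Complex.I * t)) ∘ l := by
    ext y
    simp [expo_apply, l, mul_comm]
  have hc : ContDiff ℝ k (fun t : ℝ => Complex.exp (2 * Real.pi * Complex.I * t)) :=
    Complex.contDiff_exp.comp (contDiff_const.mul Complex.ofRealCLM.contDiff)
  rw [hf, l.iteratedFDeriv_comp_right hc x le_rfl]
  refine (ContinuousMultilinearMap.norm_compContinuousLinearMap_le _ _).trans ?_
  rw [norm_iteratedFDeriv_eq_norm_iteratedDeriv, iteratedDeriv_exp_two_pi_I, Finset.prod_const,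
    Finset.card_univ, Fintype.card_fin, norm_mul, norm_pow]
  have h1 : ‖Complex.exp (2 * Real.pi * Complex.I * (l x : ℂ))‖ = 1 := by
    have : (2 * Real.pi * Complex.I * (l x : ℂ)) = ((2 * Real.pi * l x : ℝ) : ℂ) * Complex.I := by
      push_cast; ring
    rw [this, Complex.norm_exp_ofReal_mul_I]
  have h2 : ‖(2 * Real.pi * Complex.I : ℂ)‖ = 2 * Real.pi := by
    simp [abs_of_pos Real.pi_pos]
  rw [h1, h2, mul_one, ← mul_pow]
  refine pow_le_pow_left₀ (by positivity) ?_ k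
  have := rho_pos ξ
  calc 2 * Real.pi * ‖l‖ ≤ 2 * Real.pi * (n * rho ξ) := by gcongr
    _ ≤ (2 * Real.pi * n + 1) * rho ξ := by nlinarith

theorem RapidDecay.summable_bound {c : (Fin n → ℤ) → ℂ} (hc : RapidDecay c) (k : ℕ) :
    Summable fun ξ => ‖c ξ‖ * ((2 * Real.pi * n + 1) * rho ξ) ^ k := by
  refine ((hc k).mul_left ((2 * Real.pi * n + 1) ^ k)).congr fun ξ => ?_
  rw [mul_pow]; ring

theorem norm_iteratedFDeriv_smul_expo_le (c : ℂ) (k : ℕ) (ξ : Fin n → ℤ) (x : Fin n → ℝ) :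
    ‖iteratedFDeriv ℝ k (fun y => c * (expo ξ).1 y) x‖ ≤
      ‖c‖ * ((2 * Real.pi * n + 1) * rho ξ) ^ k := by
  have h : (fun y => c * (expo ξ).1 y) = c • (expo ξ).1 := rfl
  rw [h, iteratedFDeriv_const_smul_apply ((expo ξ).2.1.of_le (by exact_mod_cast le_top)).contDiffAt,
    norm_smul]
  exact mul_le_mul_of_nonneg_left (norm_iteratedFDeriv_expo_le k ξ x) (norm_nonneg _)

/-- The smooth periodic function with given rapidly decaying Fourier coefficients. -/
def fourierSeries (c : (Fin n → ℤ) → ℂ) (hc : RapidDecay c) : CInf n :=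
  ⟨fun x => ∑' ξ, c ξ * (expo ξ).1 x, by
    refine ⟨contDiff_tsum (N := ⊤) (fun ξ => contDiff_const.mul (expo ξ).2.1)
      (fun k _ => hc.summable_bound k)
      (fun k ξ x _ => norm_iteratedFDeriv_smul_expo_le (c ξ) k ξ x), fun η x => ?_⟩
    simp only [(expo _).2.2 η x]⟩

/-- One bound serves all orders up to m, which is the form required by the continuity condition in
`Distr`. -/
theorem norm_iteratedFDeriv_fourierSeries_le {c : (Fin n → ℤ) → ℂ} (hc : RapidDecay c)
    {k m : ℕ} (hk : k ≤ m) (x : Fin n → ℝ) :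
    ‖iteratedFDeriv ℝ k (fourierSeries c hc).1 x‖ ≤
      ∑' ξ, ‖c ξ‖ * ((2 * Real.pi * n + 1) * rho ξ) ^ m := by
  change ‖iteratedFDeriv ℝ k (fun x => ∑' ξ, c ξ * (expo ξ).1 x) x‖ ≤ _
  rw [iteratedFDeriv_tsum_apply (N := ⊤) (fun ξ => contDiff_const.mul (expo ξ).2.1)
      (fun k _ => hc.summable_bound k)
      (fun k ξ x _ => norm_iteratedFDeriv_smul_expo_le (c ξ) k ξ x) (k := k) le_top x]
  refine tsum_of_norm_bounded (hc.summable_bound m).hasSum fun ξ => ?_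
  refine (norm_iteratedFDeriv_smul_expo_le (c ξ) k ξ x).trans ?_
  refine mul_le_mul_of_nonneg_left (pow_le_pow_right₀ ?_ hk) (norm_nonneg _)
  have := one_le_rho ξ
  have h2 : 0 ≤ 2 * Real.pi * n := by positivity
  nlinarith

theorem RapidDecay.summable_mul_expo {c : (Fin n → ℤ) → ℂ} (hc : RapidDecay c) (x : Fin n → ℝ) :
    Summable fun ξ => c ξ * (expo ξ).1 x := by
  refine Summable.of_norm ?_
  simpa [norm_expo] using hc 0

/-- The remainder is again a Fourier series, so its seminorms are controlled by the tail of the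
coefficients. -/
theorem fourierSeries_sub_sum {c : (Fin n → ℤ) → ℂ} (hc : RapidDecay c)
    (F : Finset (Fin n → ℤ)) (hd : RapidDecay (Set.indicator (F : Set (Fin n → ℤ))ᶜ c)) :
    fourierSeries c hc - ∑ ξ ∈ F, c ξ • expo ξ = fourierSeries _ hd := by
  ext x
  have h1 := (hc.summable_mul_expo x).sum_add_tsum_compl (s := F)
  rw [tsum_subtype (F : Set (Fin n → ℤ))ᶜ (fun ξ => c ξ * (expo ξ).1 x)] at h1
  have h2 : (∑ ξ ∈ F, c ξ • expo ξ : CInf n).1 x = ∑ ξ ∈ F, c ξ * (expo ξ).1 x := by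
    simp [Finset.sum_apply]
  change (fourierSeries c hc).1 x - (∑ ξ ∈ F, c ξ • expo ξ : CInf n).1 x = _
  rw [h2]
  change (∑' ξ, c ξ * (expo ξ).1 x) - _ =
    ∑' ξ, Set.indicator (F : Set (Fin n → ℤ))ᶜ c ξ * (expo ξ).1 x
  rw [← h1, add_sub_cancel_left]
  refine tsum_congr fun ξ => ?_
  by_cases h : ξ ∈ F <;> simp [h]

/-- A distribution acts on a Fourier series term by term. -/
theorem hasSum_apply_fourierSeries (g : Distr n) {c : (Fin n → ℤ) → ℂ} (hc : RapidDecay c) :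
    HasSum (fun ξ => c ξ * g.1 (expo ξ)) (g.1 (fourierSeries c hc)) := by
  obtain ⟨m, C, h⟩ := g.2
  -- Continuity of g bounds the error after a finite set F by C times this tail.
  have h0 := (tendsto_tsum_compl_atTop_zero
    fun ξ => ‖c ξ‖ * ((2 * Real.pi * n + 1) * rho ξ) ^ m).const_mul C
  rw [mul_zero] at h0
  rw [HasSum, tendsto_iff_norm_sub_tendsto_zero]
  refine squeeze_zero (fun _ => norm_nonneg _) (fun F => ?_) h0
  have hd : RapidDecay (Set.indicator (F : Set (Fin n → ℤ))ᶜ c) :=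
    hc.mono fun ξ => norm_indicator_le_norm_self _ _
  have h1 : (∑ ξ ∈ F, c ξ * g.1 (expo ξ)) - g.1 (fourierSeries c hc) =
      -(g.1 (fourierSeries _ hd)) := by
    rw [← fourierSeries_sub_sum hc F hd, map_sub, map_sum]
    simp
  rw [h1, norm_neg]
  refine h _ _ fun k hk x => (norm_iteratedFDeriv_fourierSeries_le hd hk x).trans_eq ?_
  have h2 := tsum_subtype (F : Set (Fin n → ℤ))ᶜ
    (fun ξ => ‖c ξ‖ * ((2 * Real.pi * n + 1) * rho ξ) ^ m)
  refine Eq.trans (tsum_congr fun ξ => ?_) h2.symm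
  by_cases h : ξ ∈ F <;> simp [h]

/-! ### Fourier inversion through the quotient torus -/

/-- The covering map of the torus. -/
def torusMap (n : ℕ) : C(Fin n → ℝ, UnitAddTorus (Fin n)) where
  toFun x i := (x i : UnitAddCircle)
  continuous_toFun := continuous_pi fun i =>
    (AddCircle.continuous_mk' 1).comp (continuous_apply i)

theorem isQuotientMap_torusMap : Topology.IsQuotientMap (torusMap n) := by
  have h : ∀ i : Fin n, IsOpenQuotientMap (fun t : ℝ => (t : UnitAddCircle)) := fun _ =>
    QuotientAddGroup.isOpenQuotientMap_mk
  have hm : IsOpenQuotientMap (torusMap n) :=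
    ⟨Function.Surjective.piMap fun i => (h i).surjective,
      Continuous.piMap fun i => (h i).continuous,
      IsOpenMap.piMap (fun i => (h i).isOpenMap) (Filter.Eventually.of_forall
        fun i => (h i).surjective)⟩
  exact hm.isQuotientMap

theorem factorsThrough_torusMap (φ : CInf n) : Function.FactorsThrough φ.1 (torusMap n) := by
  intro x y hxy
  have h : ∀ i, ∃ m : ℤ, y i = x i + m := fun i => by
    have h1 := congrFun hxy i
    obtain ⟨m, hm⟩ := AddSubgroup.mem_zmultiples_iff.1 (QuotientAddGroup.eq.1 h1)
    refine ⟨m, ?_⟩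
    simp at hm
    linarith
  choose m hm using h
  have : y = x + fun i => (m i : ℝ) := funext hm
  rw [this, φ.2.2]

/-- A smooth periodic function as a continuous function on the torus. -/
def toTorus (φ : CInf n) : C(UnitAddTorus (Fin n), ℂ) :=
  isQuotientMap_torusMap.lift ⟨φ.1, φ.2.1.continuous⟩ (factorsThrough_torusMap φ)

theorem toTorus_torusMap (φ : CInf n) (x : Fin n → ℝ) : toTorus φ (torusMap n x) = φ.1 x :=
  congrArg (fun F : C(Fin n → ℝ, ℂ) => F x)
    (isQuotientMap_torusMap.lift_comp ⟨φ.1, φ.2.1.continuous⟩ (factorsThrough_torusMap φ))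

theorem mFourier_torusMap (ξ : Fin n → ℤ) (x : Fin n → ℝ) :
    UnitAddTorus.mFourier ξ (torusMap n x) = (expo ξ).1 x := by
  change ∏ j, fourier (ξ j) ((x j : ℝ) : UnitAddCircle) = _
  rw [expo_apply, Finset.mul_sum, Complex.exp_sum]
  refine Finset.prod_congr rfl fun j _ => ?_
  refine (fourier_coe_apply (T := 1)).trans ?_
  congr 1
  push_cast
  ring

theorem mFourierCoeff_toTorus (φ : CInf n) (ξ : Fin n → ℤ) :
    UnitAddTorus.mFourierCoeff (toTorus φ) ξ = fourierCoeff (ofSmooth φ) ξ := by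
  rw [UnitAddTorus.mFourierCoeff_eq_integral _ _ 0,
    ← MeasureTheory.setIntegral_congr_set cube_ae_eq_Ioc]
  refine MeasureTheory.integral_congr_ae (Filter.Eventually.of_forall fun x => ?_)
  change UnitAddTorus.mFourier (-ξ) (torusMap n x) • toTorus φ (torusMap n x) =
    φ.1 x * (expo (-ξ)).1 x
  rw [mFourier_torusMap, toTorus_torusMap, smul_eq_mul, mul_comm]

/-- Fourier inversion for smooth periodic functions. -/
theorem fourierSeries_fourierCoeff (φ : CInf n) :
    fourierSeries _ (rapidDecay_fourierCoeff_ofSmooth φ) = φ := by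
  ext x
  have hs : Summable (UnitAddTorus.mFourierCoeff (toTorus φ)) := by
    refine Summable.of_norm ?_
    simp only [mFourierCoeff_toTorus]
    simpa using rapidDecay_fourierCoeff_ofSmooth φ 0
  have h := UnitAddTorus.hasSum_mFourier_series_apply_of_summable hs (torusMap n x)
  simp only [mFourierCoeff_toTorus, toTorus_torusMap, mFourier_torusMap, smul_eq_mul] at h
  exact h.tsum_eq

/-- A distribution with rapidly decaying Fourier coefficients is a smooth function. -/
theorem eq_ofSmooth_of_rapidDecay (g : Distr n) (hg : RapidDecay (fourierCoeff g)) :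
    g = ofSmooth (fourierSeries _ hg) := by
  refine Subtype.ext (LinearMap.ext fun ψ => ?_)
  have h1 := hasSum_apply_fourierSeries g (rapidDecay_fourierCoeff_ofSmooth ψ)
  rw [fourierSeries_fourierCoeff] at h1
  have h2 := hasSum_apply_fourierSeries (ofSmooth ψ) hg
  rw [ofSmooth_comm] at h2
  refine h1.unique ?_
  -- The coefficient at ξ is the value on the exponential of `-ξ`, so the two pairings match after
  -- reflecting the frequencies.
  rw [← (Equiv.neg (Fin n → ℤ)).hasSum_iff]
  refine h2.congr_fun fun ξ => ?_
  simp [fourierCoeff, mul_comm]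

/-! ### The Stokes symbol: coercivity and a priori bounds -/

/-- The symbol of the viscous operator (up to the factor `-4π²`). -/
def viscousSymbol (a : Fin n → Fin n → Fin n → Fin n → ℝ) (ξ : Fin n → ℤ) (w : Fin n → ℂ)
    (k : Fin n) : ℂ :=
  ∑ α, ∑ j, ∑ β, (a k j α β : ℂ) * ξ α * ξ β * w j

/-- A tensor symmetric in two indices does not see symmetrisation of what it is contracted with.
This replaces the strain by the plain gradient. -/
theorem sum_symm_mul {K : Type*} [Field K] [CharZero K] (T : Fin n → Fin n → K)
    (hT : ∀ i j, T i j = T j i) (x y : Fin n → K) :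
    ∑ i, ∑ j, T i j * ((x i * y j + x j * y i) / 2) = ∑ i, ∑ j, T i j * (x j * y i) := by
  have h : ∑ i, ∑ j, T i j * (x i * y j) = ∑ i, ∑ j, T i j * (x j * y i) := by
    rw [Finset.sum_comm]
    exact Finset.sum_congr rfl fun i _ => Finset.sum_congr rfl fun j _ => by rw [hT]
  have h2 : ∑ i, ∑ j, T i j * ((x i * y j + x j * y i) / 2) =
      (∑ i, ∑ j, T i j * (x i * y j) + ∑ i, ∑ j, T i j * (x j * y i)) / 2 := by
    rw [← Finset.sum_add_distrib, Finset.sum_div]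
    refine Finset.sum_congr rfl fun i _ => ?_
    rw [← Finset.sum_add_distrib, Finset.sum_div]
    exact Finset.sum_congr rfl fun j _ => by ring
  rw [h2, h]
  ring

/-- Symmetry in (j, β) merges the two halves of the strain; the two derivatives contribute `(2πi)² =
-4π²`. -/
theorem fourierCoeff_viscousOp {a : Fin n → Fin n → Fin n → Fin n → ℝ} (ha : IsSymmTensor a)
    (u : Fin n → Distr n) (k : Fin n) (ξ : Fin n → ℤ) :
    fourierCoeff (viscousOp a u k) ξ =
      -(4 * Real.pi ^ 2) * viscousSymbol a ξ (fun j => fourierCoeff (u j) ξ) k := by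
  simp only [viscousOp, strain, fourierCoeff_sum, fourierCoeff_distDeriv, fourierCoeff_smul,
    fourierCoeff_add, viscousSymbol]
  rw [Finset.mul_sum]
  refine Finset.sum_congr rfl fun α _ => ?_
  have h := sum_symm_mul (K := ℂ) (fun j β => (a k j α β : ℂ))
    (fun j β => by rw [(ha k j α β).2]) (fun j => (ξ j : ℂ)) (fun j => fourierCoeff (u j) ξ)
  have h1 : ∑ j, ∑ β, (a k j α β : ℂ) * (1 / 2 * (2 * Real.pi * Complex.I * ξ j *
      fourierCoeff (u β) ξ + 2 * Real.pi * Complex.I * ξ β * fourierCoeff (u j) ξ)) =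
      2 * Real.pi * Complex.I * ∑ j, ∑ β, (a k j α β : ℂ) *
        ((ξ j * fourierCoeff (u β) ξ + ξ β * fourierCoeff (u j) ξ) / 2) := by
    simp only [Finset.mul_sum]
    exact Finset.sum_congr rfl fun j _ => Finset.sum_congr rfl fun β _ => by ring
  rw [h1, h]
  simp only [Finset.mul_sum]
  refine Finset.sum_congr rfl fun j _ => Finset.sum_congr rfl fun β _ => ?_
  linear_combination (4 * Real.pi ^ 2 * ξ α * a k j α β * ξ β * fourierCoeff (u j) ξ : ℂ) *
    Complex.I_sq

/-- Coercivity of the symbol on vectors orthogonal to the frequency. -/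
theorem coercive_real {a : Fin n → Fin n → Fin n → Fin n → ℝ} (ha : IsSymmTensor a) {C : ℝ}
    (hC : ∀ ζ : Matrix (Fin n) (Fin n) ℝ, ζ.IsSymm → ζ.trace = 0 →
      ∑ k, ∑ α, ζ k α ^ 2 ≤ C * ∑ k, ∑ j, ∑ α, ∑ β, a k j α β * ζ k α * ζ j β)
    (ξ w : Fin n → ℝ) (h0 : ∑ j, ξ j * w j = 0) :
    (∑ j, ξ j ^ 2) * (∑ j, w j ^ 2) ≤
      2 * C * ∑ k, w k * ∑ α, ∑ j, ∑ β, a k j α β * ξ α * ξ β * w j := by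
  -- The test matrix is the symmetric part of `ξ ⊗ w`; its trace is `ξ · w = 0`.
  have h1 := hC (Matrix.of fun k α => (ξ k * w α + ξ α * w k) / 2)
    (Matrix.IsSymm.ext fun i j => by simp only [Matrix.of_apply]; ring)
    (by
      rw [Matrix.trace, ← h0]
      exact Finset.sum_congr rfl fun i _ => by simp only [Matrix.diag_apply, Matrix.of_apply]; ring)
  simp only [Matrix.of_apply] at h1
  -- The cross term in the square is a multiple of `(ξ · w)²` and vanishes.
  have h2 : ∑ k, ∑ α, ((ξ k * w α + ξ α * w k) / 2) ^ 2 =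
      (∑ j, ξ j ^ 2) * (∑ j, w j ^ 2) / 2 := by
    have e : ∀ k α, ((ξ k * w α + ξ α * w k) / 2) ^ 2 =
        (ξ k ^ 2 * w α ^ 2) / 4 + (w k ^ 2 * ξ α ^ 2) / 4 + ((ξ k * w k) * (ξ α * w α)) / 2 :=
      fun k α => by ring
    simp only [e, Finset.sum_add_distrib, ← Finset.sum_div, ← Finset.mul_sum, ← Finset.sum_mul, h0]
    ring
  have h3 : ∑ k, ∑ j, ∑ α, ∑ β, a k j α β * ((ξ k * w α + ξ α * w k) / 2) *
        ((ξ j * w β + ξ β * w j) / 2) =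
      ∑ k, w k * ∑ α, ∑ j, ∑ β, a k j α β * ξ α * ξ β * w j := by
    have e1 : ∀ k α, ∑ j, ∑ β, a k j α β * ((ξ j * w β + ξ β * w j) / 2) =
        ∑ j, ∑ β, a k j α β * (ξ β * w j) := fun k α =>
      sum_symm_mul (fun j β => a k j α β) (fun j β => (ha k j α β).2) ξ w
    have e2 := sum_symm_mul (fun k α => ∑ j, ∑ β, a k j α β * (ξ β * w j))
      (fun k α => Finset.sum_congr rfl fun j _ => Finset.sum_congr rfl fun β _ => by
        rw [(ha k j α β).1]) ξ w
    calc _ = ∑ k, ∑ α, (∑ j, ∑ β, a k j α β * ((ξ j * w β + ξ β * w j) / 2)) *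
          ((ξ k * w α + ξ α * w k) / 2) := by
          refine Finset.sum_congr rfl fun k _ => ?_
          rw [Finset.sum_comm]
          refine Finset.sum_congr rfl fun α _ => ?_
          simp only [Finset.sum_mul]
          exact Finset.sum_congr rfl fun j _ => Finset.sum_congr rfl fun β _ => by ring
      _ = _ := by
          simp only [e1, e2]
          refine Finset.sum_congr rfl fun k _ => ?_
          rw [Finset.mul_sum]
          refine Finset.sum_congr rfl fun α _ => ?_
          simp only [Finset.sum_mul, Finset.mul_sum]
          exact Finset.sum_congr rfl fun j _ => Finset.sum_congr rfl fun β _ => by ring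
  rw [h2, h3] at h1
  linarith

theorem viscousSymbol_re (a : Fin n → Fin n → Fin n → Fin n → ℝ) (ξ : Fin n → ℤ)
    (w : Fin n → ℂ) (k : Fin n) : (viscousSymbol a ξ w k).re =
      ∑ α, ∑ j, ∑ β, a k j α β * (ξ α : ℝ) * (ξ β : ℝ) * (w j).re := by
  simp only [viscousSymbol, Complex.re_sum]
  refine Finset.sum_congr rfl fun α _ => Finset.sum_congr rfl fun j _ =>
    Finset.sum_congr rfl fun β _ => ?_
  rw [show (a k j α β : ℂ) * ξ α * ξ β = ((a k j α β * ξ α * ξ β : ℝ) : ℂ) by push_cast; ring,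
    Complex.re_ofReal_mul]

theorem viscousSymbol_im (a : Fin n → Fin n → Fin n → Fin n → ℝ) (ξ : Fin n → ℤ)
    (w : Fin n → ℂ) (k : Fin n) : (viscousSymbol a ξ w k).im =
      ∑ α, ∑ j, ∑ β, a k j α β * (ξ α : ℝ) * (ξ β : ℝ) * (w j).im := by
  simp only [viscousSymbol, Complex.im_sum]
  refine Finset.sum_congr rfl fun α _ => Finset.sum_congr rfl fun j _ =>
    Finset.sum_congr rfl fun β _ => ?_
  rw [show (a k j α β : ℂ) * ξ α * ξ β = ((a k j α β * ξ α * ξ β : ℝ) : ℂ) by push_cast; ring,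
    Complex.im_ofReal_mul]

/-- The symbol has real entries, so the real and imaginary parts of w decouple and the real estimate
applies to each. -/
theorem coercive_complex {a : Fin n → Fin n → Fin n → Fin n → ℝ} (ha : IsSymmTensor a) {C : ℝ}
    (hC : ∀ ζ : Matrix (Fin n) (Fin n) ℝ, ζ.IsSymm → ζ.trace = 0 →
      ∑ k, ∑ α, ζ k α ^ 2 ≤ C * ∑ k, ∑ j, ∑ α, ∑ β, a k j α β * ζ k α * ζ j β)
    (ξ : Fin n → ℤ) (w : Fin n → ℂ) (h0 : ∑ j, (ξ j : ℂ) * w j = 0) :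
    (∑ j, (ξ j : ℝ) ^ 2) * (∑ j, ‖w j‖ ^ 2) ≤
      2 * C * (∑ k, (starRingEnd ℂ) (w k) * viscousSymbol a ξ w k).re := by
  have hre : ∑ j, (ξ j : ℝ) * (w j).re = 0 := by
    have := congrArg Complex.re h0
    simpa [Complex.re_sum] using this
  have him : ∑ j, (ξ j : ℝ) * (w j).im = 0 := by
    have := congrArg Complex.im h0
    simpa [Complex.im_sum] using this
  have h1 := coercive_real ha hC _ _ hre
  have h2 := coercive_real ha hC _ _ him
  have e1 : ∑ j, ‖w j‖ ^ 2 = ∑ j, (w j).re ^ 2 + ∑ j, (w j).im ^ 2 := by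
    rw [← Finset.sum_add_distrib]
    refine Finset.sum_congr rfl fun j _ => ?_
    rw [Complex.sq_norm, Complex.normSq_apply]; ring
  have e2 : (∑ k, (starRingEnd ℂ) (w k) * viscousSymbol a ξ w k).re =
      ∑ k, (w k).re * (viscousSymbol a ξ w k).re + ∑ k, (w k).im * (viscousSymbol a ξ w k).im := by
    rw [Complex.re_sum, ← Finset.sum_add_distrib]
    refine Finset.sum_congr rfl fun k _ => ?_
    simp [Complex.mul_re]
  rw [e1, e2]
  simp only [viscousSymbol_re, viscousSymbol_im]
  linarith

theorem norm_viscousSymbol_le (a : Fin n → Fin n → Fin n → Fin n → ℝ) (ξ : Fin n → ℤ)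
    (w : Fin n → ℂ) (k : Fin n) : ‖viscousSymbol a ξ w k‖ ≤
      (∑ k, ∑ α, ∑ j, ∑ β, |a k j α β|) * (rho ξ ^ 2 * ∑ j, ‖w j‖) := by
  have hρ := rho_pos ξ
  have h : ‖viscousSymbol a ξ w k‖ ≤
      (∑ α, ∑ j, ∑ β, |a k j α β|) * (rho ξ ^ 2 * ∑ j, ‖w j‖) := by
    simp only [Finset.sum_mul]
    refine norm_sum_le_of_le _ fun α _ => norm_sum_le_of_le _ fun j _ =>
      norm_sum_le_of_le _ fun β _ => ?_
    have h1 : ‖w j‖ ≤ ∑ j, ‖w j‖ :=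
      Finset.single_le_sum (f := fun j => ‖w j‖) (fun _ _ => norm_nonneg _) (Finset.mem_univ j)
    have h2 := abs_le_rho ξ α
    have h3 := abs_le_rho ξ β
    rw [norm_mul, norm_mul, norm_mul, Complex.norm_real, Complex.norm_intCast,
      Complex.norm_intCast, Real.norm_eq_abs]
    calc _ = |a k j α β| * ((|(ξ α : ℝ)| * |(ξ β : ℝ)|) * ‖w j‖) := by ring
      _ ≤ |a k j α β| * ((rho ξ * rho ξ) * ∑ j, ‖w j‖) := by gcongr
      _ = _ := by ring
  refine h.trans (mul_le_mul_of_nonneg_right ?_ (by positivity))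
  exact Finset.single_le_sum (f := fun k => ∑ α, ∑ j, ∑ β, |a k j α β|)
    (fun _ _ => by positivity) (Finset.mem_univ k)

/-- A nonzero integer vector satisfies `|ξ|² ≥ 1`, which absorbs the 1 in ρ². -/
theorem rho_sq_le (ξ : Fin n → ℤ) (hξ : ξ ≠ 0) : rho ξ ^ 2 ≤ 2 * ∑ j, (ξ j : ℝ) ^ 2 := by
  rw [rho_sq]
  obtain ⟨j, hj⟩ := Function.ne_iff.1 hξ
  have h1 := Finset.single_le_sum (f := fun j => (ξ j : ℝ) ^ 2) (fun i _ => sq_nonneg _)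
    (Finset.mem_univ j)
  have h2 : (1 : ℝ) ≤ (ξ j : ℝ) ^ 2 := by
    have : (1 : ℤ) ≤ ξ j ^ 2 := Int.add_one_le_iff.2 (sq_pos_of_ne_zero hj)
    exact_mod_cast this
  linarith

/-- A priori estimate for the velocity in the Stokes system, on the Fourier side. -/
theorem stokes_velocity_bound {a : Fin n → Fin n → Fin n → Fin n → ℝ} (ha : IsSymmTensor a) {C : ℝ}
    (hC0 : 0 < C) (hC : ∀ ζ : Matrix (Fin n) (Fin n) ℝ, ζ.IsSymm → ζ.trace = 0 →
      ∑ k, ∑ α, ζ k α ^ 2 ≤ C * ∑ k, ∑ j, ∑ α, ∑ β, a k j α β * ζ k α * ζ j β)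
    {ξ : Fin n → ℤ} (hξ : ξ ≠ 0) {U : Fin n → ℂ} {P : ℂ} {G : Fin n → ℂ}
    (hdiv : ∑ j, (ξ j : ℂ) * U j = 0)
    (heq : ∀ k, 4 * Real.pi ^ 2 * viscousSymbol a ξ U k +
      2 * Real.pi * Complex.I * ξ k * P = G k) :
    rho ξ ^ 2 * ∑ k, ‖U k‖ ≤ n * (C / Real.pi ^ 2) * ∑ k, ‖G k‖ := by
  have hpi := Real.pi_pos
  have hρ2 := rho_sq_le ξ hξ
  have hU0 : 0 ≤ ∑ k, ‖U k‖ := Finset.sum_nonneg fun _ _ => norm_nonneg _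
  have hG0 : 0 ≤ ∑ k, ‖G k‖ := Finset.sum_nonneg fun _ _ => norm_nonneg _
  have hUle : ∀ k, ‖U k‖ ≤ ∑ k, ‖U k‖ := fun k =>
    Finset.single_le_sum (f := fun j => ‖U j‖) (fun _ _ => norm_nonneg _) (Finset.mem_univ k)
  have h1 := coercive_complex ha hC ξ U hdiv
  have hdiv' : ∑ k, (ξ k : ℂ) * (starRingEnd ℂ) (U k) = 0 := by
    have := congrArg (starRingEnd ℂ) hdiv
    simpa using this
  -- Paired with the conjugate of U, the pressure term contains the factor `ξ · conj U = 0`.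
  have h2 : ∑ k, (starRingEnd ℂ) (U k) * G k =
      ((4 * Real.pi ^ 2 : ℝ) : ℂ) * ∑ k, (starRingEnd ℂ) (U k) * viscousSymbol a ξ U k := by
    calc _ = ((4 * Real.pi ^ 2 : ℝ) : ℂ) * ∑ k, (starRingEnd ℂ) (U k) * viscousSymbol a ξ U k +
          2 * Real.pi * Complex.I * P * ∑ k, (ξ k : ℂ) * (starRingEnd ℂ) (U k) := by
          rw [Finset.mul_sum, Finset.mul_sum, ← Finset.sum_add_distrib]
          refine Finset.sum_congr rfl fun k _ => ?_
          rw [← heq k]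
          push_cast
          ring
      _ = _ := by rw [hdiv']; ring
  have h3 : 4 * Real.pi ^ 2 * (∑ k, (starRingEnd ℂ) (U k) * viscousSymbol a ξ U k).re ≤
      (∑ k, ‖U k‖) * ∑ k, ‖G k‖ := by
    rw [← Complex.re_ofReal_mul, ← h2]
    refine (Complex.re_le_norm _).trans ?_
    rw [Finset.mul_sum]
    refine norm_sum_le_of_le _ fun k _ => ?_
    rw [norm_mul, Complex.norm_conj]
    exact mul_le_mul_of_nonneg_right (hUle k) (norm_nonneg _)
  have h4 : (∑ k, ‖U k‖) ^ 2 ≤ n * ∑ k, ‖U k‖ ^ 2 := by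
    simpa using sq_sum_le_card_mul_sum_sq (s := Finset.univ) (f := fun k => ‖U k‖)
  have hS0 : 0 ≤ ∑ j, (ξ j : ℝ) ^ 2 := Finset.sum_nonneg fun _ _ => sq_nonneg _
  generalize (∑ k, (starRingEnd ℂ) (U k) * viscousSymbol a ξ U k).re = E at *
  generalize (∑ k, ‖U k‖) = NU at *
  generalize (∑ k, ‖G k‖) = NG at *
  generalize (∑ k, ‖U k‖ ^ 2) = QU at *
  generalize (∑ j, (ξ j : ℝ) ^ 2) = S at *
  rcases hU0.eq_or_lt with h0 | h0
  · rw [← h0, mul_zero]; positivity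
  · refine le_of_mul_le_mul_right ?_ h0
    -- The constant `n C / π²` collects 2 from `rho_sq_le`, n from Cauchy–Schwarz, 2C from
    -- coercivity and `1 / (4π²)` from the symbol.
    calc rho ξ ^ 2 * NU * NU = rho ξ ^ 2 * NU ^ 2 := by ring
      _ ≤ (2 * S) * (n * QU) := mul_le_mul hρ2 h4 (sq_nonneg _) (by positivity)
      _ = 2 * n * (S * QU) := by ring
      _ ≤ 2 * n * (2 * C * E) := mul_le_mul_of_nonneg_left h1 (by positivity)
      _ = n * (C / Real.pi ^ 2) * (4 * Real.pi ^ 2 * E) := by field_simp; ring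
      _ ≤ n * (C / Real.pi ^ 2) * (NU * NG) := mul_le_mul_of_nonneg_left h3 (by positivity)
      _ = n * (C / Real.pi ^ 2) * NG * NU := by ring

/-- The pressure in the Stokes system is controlled by the velocity and the force. -/
theorem stokes_pressure_bound (a : Fin n → Fin n → Fin n → Fin n → ℝ)
    {ξ : Fin n → ℤ} (hξ : ξ ≠ 0) {U : Fin n → ℂ} {P : ℂ} {G : Fin n → ℂ}
    (heq : ∀ k, 4 * Real.pi ^ 2 * viscousSymbol a ξ U k +
      2 * Real.pi * Complex.I * ξ k * P = G k) :
    Real.pi * (rho ξ * ‖P‖) ≤ (∑ k, ‖G k‖) +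
      n * (4 * Real.pi ^ 2 * ((∑ k, ∑ α, ∑ j, ∑ β, |a k j α β|) *
        (rho ξ ^ 2 * ∑ k, ‖U k‖))) := by
  have hpi := Real.pi_pos
  have hρ := rho_pos ξ
  have hρ2 := rho_sq_le ξ hξ
  -- The scalar product of the system with ξ isolates `|ξ|² P`.
  have h6 : (2 * Real.pi * Complex.I) * (((∑ j, (ξ j : ℝ) ^ 2 : ℝ) : ℂ) * P) =
      ∑ k, (ξ k : ℂ) * (G k - 4 * Real.pi ^ 2 * viscousSymbol a ξ U k) := by
    push_cast
    rw [Finset.sum_mul, Finset.mul_sum]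
    refine Finset.sum_congr rfl fun k _ => ?_
    rw [← heq k]
    ring
  have hS0 : 0 ≤ ∑ j, (ξ j : ℝ) ^ 2 := Finset.sum_nonneg fun _ _ => sq_nonneg _
  have e : ‖(2 * Real.pi * Complex.I) * (((∑ j, (ξ j : ℝ) ^ 2 : ℝ) : ℂ) * P)‖ =
      2 * Real.pi * ((∑ j, (ξ j : ℝ) ^ 2) * ‖P‖) := by
    have e0 : ‖(2 * Real.pi * Complex.I : ℂ)‖ = 2 * Real.pi := by simp [abs_of_pos hpi]
    rw [norm_mul, e0, norm_mul, Complex.norm_real, Real.norm_of_nonneg hS0]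
  have h7 : 2 * Real.pi * ((∑ j, (ξ j : ℝ) ^ 2) * ‖P‖) ≤
      ∑ k, rho ξ * (‖G k‖ + 4 * Real.pi ^ 2 * ((∑ k, ∑ α, ∑ j, ∑ β, |a k j α β|) *
        (rho ξ ^ 2 * ∑ k, ‖U k‖))) := by
    rw [← e, h6]
    refine norm_sum_le_of_le _ fun k _ => ?_
    rw [norm_mul, Complex.norm_intCast]
    refine mul_le_mul (abs_le_rho ξ k) ((norm_sub_le _ _).trans ?_) (norm_nonneg _) hρ.le
    refine add_le_add le_rfl ?_
    rw [norm_mul]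
    have e2 : ‖(4 * Real.pi ^ 2 : ℂ)‖ = 4 * Real.pi ^ 2 := by simp [abs_of_pos hpi]
    rw [e2]
    exact mul_le_mul_of_nonneg_left (norm_viscousSymbol_le a ξ U k) (by positivity)
  rw [← Finset.mul_sum, Finset.sum_add_distrib, Finset.sum_const, Finset.card_univ,
    Fintype.card_fin, nsmul_eq_mul] at h7
  refine le_of_mul_le_mul_left ?_ hρ
  refine le_trans ?_ h7
  calc rho ξ * (Real.pi * (rho ξ * ‖P‖)) = rho ξ ^ 2 * (Real.pi * ‖P‖) := by ring
    _ ≤ (2 * ∑ j, (ξ j : ℝ) ^ 2) * (Real.pi * ‖P‖) :=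
        mul_le_mul_of_nonneg_right hρ2 (by positivity)
    _ = 2 * Real.pi * ((∑ j, (ξ j : ℝ) ^ 2) * ‖P‖) := by ring

/-- A priori estimate for the Stokes system, on the Fourier side. -/
theorem exists_stokes_bound {a : Fin n → Fin n → Fin n → Fin n → ℝ} (ha : IsSymmTensor a)
    (hell : IsRelaxedElliptic a) :
    ∃ K : ℝ, 0 ≤ K ∧ ∀ (ξ : Fin n → ℤ), ξ ≠ 0 → ∀ (U : Fin n → ℂ) (P : ℂ) (G : Fin n → ℂ),
      ∑ j, (ξ j : ℂ) * U j = 0 →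
      (∀ k, 4 * Real.pi ^ 2 * viscousSymbol a ξ U k + 2 * Real.pi * Complex.I * ξ k * P = G k) →
      rho ξ ^ 2 * ∑ k, ‖U k‖ ≤ K * ∑ k, ‖G k‖ ∧ rho ξ * ‖P‖ ≤ K * ∑ k, ‖G k‖ := by
  obtain ⟨C, hC0, hC⟩ := hell
  have hpi := Real.pi_pos
  have hA0 : 0 ≤ ∑ k, ∑ α, ∑ j, ∑ β, |a k j α β| :=
    Finset.sum_nonneg fun _ _ => Finset.sum_nonneg fun _ _ => Finset.sum_nonneg fun _ _ =>
      Finset.sum_nonneg fun _ _ => abs_nonneg _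
  have hK : 0 ≤ n * (C / Real.pi ^ 2) := by positivity
  have key := fun (ξ : Fin n → ℤ) (hξ : ξ ≠ 0) (U : Fin n → ℂ) (P : ℂ) (G : Fin n → ℂ)
    hdiv heq => And.intro (stokes_velocity_bound ha hC0 hC hξ (U := U) (P := P) (G := G) hdiv heq)
      (stokes_pressure_bound a hξ (U := U) (P := P) (G := G) heq)
  generalize (∑ k, ∑ α, ∑ j, ∑ β, |a k j α β|) = A at *
  generalize (n * (C / Real.pi ^ 2)) = K₁ at *
  have hK₂ : 0 ≤ (1 + n * (4 * Real.pi ^ 2 * (A * K₁))) / Real.pi := by positivity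
  refine ⟨K₁ + (1 + n * (4 * Real.pi ^ 2 * (A * K₁))) / Real.pi,
    add_nonneg hK hK₂, fun ξ hξ U P G hdiv heq => ?_⟩
  obtain ⟨h5, h7⟩ := key ξ hξ U P G hdiv heq
  have hG0 : 0 ≤ ∑ k, ‖G k‖ := Finset.sum_nonneg fun _ _ => norm_nonneg _
  generalize (∑ k, ‖G k‖) = NG at *
  refine ⟨h5.trans (mul_le_mul_of_nonneg_right (le_add_of_nonneg_right hK₂) hG0),
    le_trans ?_ (mul_le_mul_of_nonneg_right (le_add_of_nonneg_left hK) hG0)⟩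
  refine le_of_mul_le_mul_left (h7.trans ?_) hpi
  calc _ ≤ NG + n * (4 * Real.pi ^ 2 * (A * (K₁ * NG))) := by gcongr
    _ = Real.pi * ((1 + n * (4 * Real.pi ^ 2 * (A * K₁))) / Real.pi * NG) := by
      field_simp

/-! ### Weighted ℓ² sequences and convolution -/

theorem rho_add_le (ξ η : Fin n → ℤ) : rho (ξ + η) ≤ rho ξ + rho η := by
  have h1 := rho_pos ξ
  have h2 := rho_pos η
  refine abs_le_of_sq_le_sq' ?_ (by positivity) |>.2
  have hcs := Finset.sum_mul_sq_le_sq_mul_sq Finset.univ (fun j => (ξ j : ℝ)) (fun j => (η j : ℝ))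
  have e1 := rho_sq ξ
  have e2 := rho_sq η
  have h3 : ∑ j, (ξ j : ℝ) * (η j : ℝ) ≤ rho ξ * rho η := by
    refine (abs_le_of_sq_le_sq' (hcs.trans ?_) (by positivity)).2
    rw [mul_pow]
    exact mul_le_mul (by linarith) (by linarith) (by positivity) (by positivity)
  have h4 : ∑ j, (((ξ + η) j : ℤ) : ℝ) ^ 2 = ∑ j, (ξ j : ℝ) ^ 2 +
      2 * ∑ j, (ξ j : ℝ) * (η j : ℝ) + ∑ j, (η j : ℝ) ^ 2 := by
    rw [Finset.mul_sum, ← Finset.sum_add_distrib, ← Finset.sum_add_distrib]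
    refine Finset.sum_congr rfl fun j _ => ?_
    push_cast [Pi.add_apply]
    ring
  rw [rho_sq, h4, add_sq, e1, e2]
  linarith

/-- With b the smallest of the three, `a ≤ 2c`. Hence s of the powers of a are absorbed by `c^(-s)`,
and the remaining exponent `s - σ ≤ 0` allows a to be replaced by b. -/
theorem weight_bound_of_min {s σ a b c : ℝ} (hs : 0 < s) (hσ : s ≤ σ) (hb : 1 ≤ b)
    (ha : b ≤ a) (hc : b ≤ c) (hac : a ≤ b + c) :
    a ^ (2 * s - σ) * (b ^ (-s) * c ^ (-s)) ≤ 2 ^ s * b ^ (-σ) := by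
  have hb0 : 0 < b := by linarith
  have ha0 : 0 < a := by linarith
  have hc0 : 0 < c := by linarith
  have h1 : a ^ s ≤ 2 ^ s * c ^ s := by
    rw [← Real.mul_rpow (by norm_num) hc0.le]
    exact Real.rpow_le_rpow ha0.le (by linarith) hs.le
  have h2 : a ^ (s - σ) ≤ b ^ (s - σ) := Real.rpow_le_rpow_of_nonpos hb0 ha (by linarith)
  have h3 : c ^ s * c ^ (-s) = 1 := by rw [← Real.rpow_add hc0]; simp
  calc a ^ (2 * s - σ) * (b ^ (-s) * c ^ (-s))
      = a ^ (s - σ) * a ^ s * (b ^ (-s) * c ^ (-s)) := by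
        rw [← Real.rpow_add ha0]; ring_nf
    _ ≤ b ^ (s - σ) * (2 ^ s * c ^ s) * (b ^ (-s) * c ^ (-s)) := by gcongr
    _ = 2 ^ s * (b ^ (s - σ) * b ^ (-s)) * (c ^ s * c ^ (-s)) := by ring
    _ = 2 ^ s * b ^ (-σ) := by rw [h3, ← Real.rpow_add hb0]; ring_nf

/-- Whichever of a, b, c is smallest carries the whole negative power `-σ`. For a this is
monotonicity; for b and c it is `weight_bound_of_min`. In the convolution a, b, c are the weights at
ξ, η and `ξ - η`. -/
theorem weight_bound {s σ a b c : ℝ} (hs : 0 < s) (hσ : s ≤ σ) (ha : 1 ≤ a) (hb : 1 ≤ b)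
    (hc : 1 ≤ c) (h1 : a ≤ b + c) :
    a ^ (2 * s - σ) * (b ^ (-s) * c ^ (-s)) ≤ 2 ^ s * (a ^ (-σ) + b ^ (-σ) + c ^ (-σ)) := by
  have ha0 : 0 < a := by linarith
  have hb0 : 0 < b := by linarith
  have hc0 : 0 < c := by linarith
  have h2 : (1 : ℝ) ≤ 2 ^ s := Real.one_le_rpow (by norm_num) hs.le
  have pa : 0 < a ^ (-σ) := Real.rpow_pos_of_pos ha0 _
  have pb : 0 < b ^ (-σ) := Real.rpow_pos_of_pos hb0 _
  have pc : 0 < c ^ (-σ) := Real.rpow_pos_of_pos hc0 _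
  by_cases hab : a ≤ b
  · by_cases hac : a ≤ c
    · calc a ^ (2 * s - σ) * (b ^ (-s) * c ^ (-s))
          ≤ a ^ (2 * s - σ) * (a ^ (-s) * a ^ (-s)) := by
            have e1 := Real.rpow_le_rpow_of_nonpos ha0 hab (show -s ≤ 0 by linarith)
            have e2 := Real.rpow_le_rpow_of_nonpos ha0 hac (show -s ≤ 0 by linarith)
            gcongr
        _ = a ^ (-σ) := by
            rw [← Real.rpow_add ha0, ← Real.rpow_add ha0]; ring_nf
        _ ≤ 2 ^ s * (a ^ (-σ) + b ^ (-σ) + c ^ (-σ)) := by nlinarith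
    · have := weight_bound_of_min hs hσ hc (by linarith : c ≤ a) (by linarith : c ≤ b)
        (by linarith)
      rw [mul_comm (b ^ (-s))]
      nlinarith
  · by_cases hbc : b ≤ c
    · have := weight_bound_of_min hs hσ hb (by linarith : b ≤ a) hbc h1
      nlinarith
    · have := weight_bound_of_min hs hσ hc (by linarith : c ≤ a) (by linarith : c ≤ b)
        (by linarith)
      rw [mul_comm (b ^ (-s))]
      nlinarith

section Sequences

variable {ι : Type*}

theorem summable_mul_of_sq {x y : ι → ℝ} (hx : Summable fun i => x i ^ 2)
    (hy : Summable fun i => y i ^ 2) : Summable fun i => x i * y i := by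
  refine Summable.of_norm_bounded (hx.add hy) fun i => ?_
  rw [Real.norm_eq_abs, abs_le]
  constructor <;> nlinarith [sq_nonneg (x i + y i), sq_nonneg (x i - y i)]

theorem tsum_mul_sq_le {x y : ι → ℝ} (hx : Summable fun i => x i ^ 2)
    (hy : Summable fun i => y i ^ 2) :
    (∑' i, x i * y i) ^ 2 ≤ (∑' i, x i ^ 2) * ∑' i, y i ^ 2 :=
  le_of_tendsto_of_tendsto' ((summable_mul_of_sq hx hy).hasSum.pow 2)
    (Filter.Tendsto.mul hx.hasSum hy.hasSum) fun F => Finset.sum_mul_sq_le_sq_mul_sq F x y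

end Sequences

variable {G : Type*} [AddCommGroup G]

theorem summable_shift {x : G → ℝ} (hx : Summable x) (ξ : G) : Summable fun η => x (ξ - η) :=
  (Equiv.subLeft ξ).summable_iff.2 hx

/-- `ℓ¹ * ℓ² ⊆ ℓ²`. -/
theorem summable_sq_tsum_mul {x y : G → ℝ} (hx0 : ∀ η, 0 ≤ x η) (hx : Summable x)
    (hy : Summable fun η => y η ^ 2) :
    (∀ ξ, Summable fun η => x η * y (ξ - η)) ∧
      Summable fun ξ => (∑' η, x η * y (ξ - η)) ^ 2 := by
  -- The substitution `(ξ, η) ↦ (η, ξ - η)` reduces double summability to that of a product of two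
  -- summable families.
  let e : G × G ≃ G × G :=
    { toFun := fun p => (p.2, p.1 - p.2)
      invFun := fun p => (p.2 + p.1, p.1)
      left_inv := fun p => by simp
      right_inv := fun p => by simp }
  have hprod : Summable fun p : G × G => x p.2 * y (p.1 - p.2) ^ 2 := by
    have := hx.mul_of_nonneg hy hx0 (fun η => sq_nonneg (y η))
    exact e.summable_iff.2 this
  have hfib : ∀ ξ, Summable fun η => x η * y (ξ - η) ^ 2 := fun ξ => hprod.prod_factor ξ
  -- Writing `x = √x · √x`, Cauchy–Schwarz gives `(∑ x y)² ≤ (∑ x) (∑ x y²)`, which is then summed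
  -- over ξ.
  have hsqrt : Summable fun η => Real.sqrt (x η) ^ 2 := by simpa [Real.sq_sqrt, hx0] using hx
  have hsq2 : ∀ ξ, Summable fun η => (Real.sqrt (x η) * y (ξ - η)) ^ 2 := fun ξ => by
    simpa [mul_pow, Real.sq_sqrt, hx0] using hfib ξ
  have hmul : ∀ ξ η, Real.sqrt (x η) * (Real.sqrt (x η) * y (ξ - η)) = x η * y (ξ - η) :=
    fun ξ η => by rw [← mul_assoc, Real.mul_self_sqrt (hx0 η)]
  refine ⟨fun ξ => (summable_mul_of_sq hsqrt (hsq2 ξ)).congr fun η => hmul ξ η, ?_⟩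
  refine Summable.of_nonneg_of_le (fun ξ => sq_nonneg _) (fun ξ => ?_)
    (hprod.prod.mul_left (∑' η, x η))
  have h := tsum_mul_sq_le hsqrt (hsq2 ξ)
  simpa only [hmul, mul_pow, Real.sq_sqrt (hx0 _)] using h

theorem tsum_mul_sub_comm (x y : G → ℝ) (ξ : G) :
    ∑' η, x η * y (ξ - η) = ∑' η, y η * x (ξ - η) := by
  rw [← (Equiv.subLeft ξ).tsum_eq]
  exact tsum_congr fun η => by simp [mul_comm]

/-- Membership in the weighted space `ℓ²(ρ^s)`. -/
def WeightedL2 (s : ℝ) (f : (Fin n → ℤ) → ℝ) : Prop :=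
  Summable fun ξ => rho ξ ^ (2 * s) * f ξ ^ 2

theorem weightedL2_iff {s : ℝ} {f : (Fin n → ℤ) → ℝ} :
    WeightedL2 s f ↔ Summable fun ξ => (rho ξ ^ s * f ξ) ^ 2 := by
  refine summable_congr fun ξ => ?_
  rw [mul_pow, ← Real.rpow_natCast (rho ξ ^ s), ← Real.rpow_mul (rho_pos ξ).le, mul_comm s]
  norm_num

theorem WeightedL2.mono {s : ℝ} {f g : (Fin n → ℤ) → ℝ} (hg : WeightedL2 s g)
    (h0 : ∀ ξ, 0 ≤ f ξ) (h : ∀ ξ, f ξ ≤ g ξ) : WeightedL2 s f := by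
  refine Summable.of_nonneg_of_le (fun ξ => ?_) (fun ξ => ?_) hg
  · have := rho_pos ξ; positivity
  · exact mul_le_mul_of_nonneg_left (pow_le_pow_left₀ (h0 ξ) (h ξ) 2)
      (Real.rpow_nonneg (rho_pos ξ).le _)

theorem WeightedL2.mono_weight {s t : ℝ} {f : (Fin n → ℤ) → ℝ} (hf : WeightedL2 s f)
    (h : t ≤ s) : WeightedL2 t f := by
  refine Summable.of_nonneg_of_le (fun ξ => ?_) (fun ξ => ?_) hf
  · have := rho_pos ξ; positivity
  · exact mul_le_mul_of_nonneg_right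
      (Real.rpow_le_rpow_of_exponent_le (one_le_rho ξ) (by linarith)) (sq_nonneg _)

theorem WeightedL2.add {s : ℝ} {f g : (Fin n → ℤ) → ℝ} (hf : WeightedL2 s f)
    (hg : WeightedL2 s g) : WeightedL2 s fun ξ => f ξ + g ξ := by
  refine Summable.of_nonneg_of_le (fun ξ => ?_) (fun ξ => ?_) ((Summable.add hf hg).mul_left 2)
  · have := rho_pos ξ; positivity
  · have h1 : 0 ≤ rho ξ ^ (2 * s) := Real.rpow_nonneg (rho_pos ξ).le _
    nlinarith [mul_nonneg h1 (sq_nonneg (f ξ - g ξ))]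

theorem weightedL2_zero (s : ℝ) : WeightedL2 s fun _ : Fin n → ℤ => 0 := by
  simp [WeightedL2, summable_zero]

theorem WeightedL2.sum {ι : Type*} {s : ℝ} {f : ι → (Fin n → ℤ) → ℝ} (F : Finset ι)
    (h : ∀ i ∈ F, WeightedL2 s (f i)) : WeightedL2 s fun ξ => ∑ i ∈ F, f i ξ := by
  classical
  induction F using Finset.induction_on with
  | empty => simpa using weightedL2_zero s
  | insert i F hi ih =>
    simp only [Finset.sum_insert hi]
    exact (h i (Finset.mem_insert_self i F)).add
      (ih fun j hj => h j (Finset.mem_insert_of_mem hj))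

theorem WeightedL2.const_mul {s : ℝ} {f : (Fin n → ℤ) → ℝ} (hf : WeightedL2 s f) (c : ℝ) :
    WeightedL2 s fun ξ => c * f ξ :=
  (Summable.mul_left (c ^ 2) hf).congr fun ξ => by ring

theorem WeightedL2.rho_mul {s : ℝ} {f : (Fin n → ℤ) → ℝ} (hf : WeightedL2 s f) (t : ℝ) :
    WeightedL2 (s - t) fun ξ => rho ξ ^ t * f ξ := by
  rw [weightedL2_iff] at hf ⊢
  refine hf.congr fun ξ => ?_
  rw [← mul_assoc, ← Real.rpow_add (rho_pos ξ), sub_add_cancel]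

/-- Products in Sobolev spaces, on the Fourier side. -/
theorem WeightedL2.convolution {s σ : ℝ} (hs : 0 < s) (hσ : s ≤ σ) (hn : (n : ℝ) < 2 * σ)
    {f g : (Fin n → ℤ) → ℝ} (hf0 : ∀ ξ, 0 ≤ f ξ) (hg0 : ∀ ξ, 0 ≤ g ξ)
    (hf : WeightedL2 s f) (hg : WeightedL2 s g) :
    (∀ ξ, Summable fun η => f η * g (ξ - η)) ∧
      WeightedL2 (2 * s - σ) fun ξ => ∑' η, f η * g (ξ - η) := by
  have hf' := weightedL2_iff.1 (hf.mono_weight hs.le)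
  have hg' := weightedL2_iff.1 (hg.mono_weight hs.le)
  simp only [Real.rpow_zero, one_mul] at hf' hg'
  have hsum : ∀ ξ, Summable fun η => f η * g (ξ - η) := fun ξ =>
    summable_mul_of_sq hf' (summable_shift hg' ξ)
  refine ⟨hsum, ?_⟩
  rw [weightedL2_iff] at hf hg ⊢
  -- F and G carry the weights of f and g and are square summable; the powers `ρ^(-s)` left over go
  -- into `weight_bound`.
  obtain ⟨F, hF⟩ : ∃ F : (Fin n → ℤ) → ℝ, ∀ ξ, F ξ = rho ξ ^ s * f ξ := ⟨_, fun _ => rfl⟩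
  obtain ⟨G, hG⟩ : ∃ G : (Fin n → ℤ) → ℝ, ∀ ξ, G ξ = rho ξ ^ s * g ξ := ⟨_, fun _ => rfl⟩
  have e : ∀ (ζ : Fin n → ℤ) (r : ℝ), r = rho ζ ^ (-s) * (rho ζ ^ s * r) := fun ζ r => by
    rw [← mul_assoc, ← Real.rpow_add (rho_pos ζ)]; simp
  have hfF : ∀ ξ, f ξ = rho ξ ^ (-s) * F ξ := fun ξ => by rw [hF, ← e]
  have hgG : ∀ ξ, g ξ = rho ξ ^ (-s) * G ξ := fun ξ => by rw [hG, ← e]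
  simp only [← hF] at hf
  simp only [← hG] at hg
  have hρ0 : ∀ (ξ : Fin n → ℤ) (r : ℝ), 0 ≤ rho ξ ^ r := fun ξ r =>
    Real.rpow_nonneg (rho_pos ξ).le r
  have hF0 : ∀ ξ, 0 ≤ F ξ := fun ξ => hF ξ ▸ mul_nonneg (hρ0 ξ s) (hf0 ξ)
  have hG0 : ∀ ξ, 0 ≤ G ξ := fun ξ => hG ξ ▸ mul_nonneg (hρ0 ξ s) (hg0 ξ)
  -- Here `2σ > n` enters: `ρ^(-σ)` is in ℓ², so `ρ^(-σ) F` and `ρ^(-σ) G` are in ℓ¹.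
  have hw : Summable fun ξ : Fin n → ℤ => (rho ξ ^ (-σ)) ^ 2 := by
    refine (summable_rho_rpow (n := n) (-(2 * σ)) (by linarith)).congr fun ξ => ?_
    rw [← Real.rpow_natCast, ← Real.rpow_mul (rho_pos ξ).le]
    congr 1
    push_cast
    ring
  have hFw := summable_mul_of_sq hw hf
  have hGw := summable_mul_of_sq hw hg
  obtain ⟨hX, hX2⟩ := summable_sq_tsum_mul (fun ξ => mul_nonneg (hρ0 ξ _) (hF0 ξ)) hFw hg
  obtain ⟨hY, hY2⟩ := summable_sq_tsum_mul (fun ξ => mul_nonneg (hρ0 ξ _) (hG0 ξ)) hGw hf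
  have hZ : ∀ ξ, Summable fun η => F η * G (ξ - η) := fun ξ =>
    summable_mul_of_sq hf (summable_shift hg ξ)
  have hY' : ∀ ξ, Summable fun η => F η * (rho (ξ - η) ^ (-σ) * G (ξ - η)) := fun ξ =>
    (summable_shift (hY ξ) ξ).congr fun η => by simp [mul_comm]
  have hZ2 : ∀ ξ, (∑' η, F η * G (ξ - η)) ^ 2 ≤ (∑' η, F η ^ 2) * ∑' η, G η ^ 2 := fun ξ => by
    refine (tsum_mul_sq_le hf (summable_shift hg ξ)).trans_eq ?_
    rw [← (Equiv.subLeft ξ).tsum_eq fun η => G η ^ 2]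
    rfl
  -- Of the three terms, the first two are convolutions of ℓ¹ with ℓ²; in the third `F * G` is
  -- bounded by Cauchy–Schwarz and `ρ^(-σ)` is in ℓ².
  have hpt : ∀ ξ η, rho ξ ^ (2 * s - σ) * (f η * g (ξ - η)) ≤
      2 ^ s * ((rho η ^ (-σ) * F η) * G (ξ - η) + F η * (rho (ξ - η) ^ (-σ) * G (ξ - η)) +
        rho ξ ^ (-σ) * (F η * G (ξ - η))) := fun ξ η => by
    have h1 : rho ξ ≤ rho η + rho (ξ - η) := by simpa using rho_add_le η (ξ - η)
    have h2 := weight_bound hs hσ (one_le_rho ξ) (one_le_rho η) (one_le_rho (ξ - η)) h1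
    calc rho ξ ^ (2 * s - σ) * (f η * g (ξ - η))
        = (rho ξ ^ (2 * s - σ) * (rho η ^ (-s) * rho (ξ - η) ^ (-s))) * (F η * G (ξ - η)) := by
          rw [hfF, hgG]; ring
      _ ≤ (2 ^ s * (rho ξ ^ (-σ) + rho η ^ (-σ) + rho (ξ - η) ^ (-σ))) * (F η * G (ξ - η)) :=
          mul_le_mul_of_nonneg_right h2 (mul_nonneg (hF0 _) (hG0 _))
      _ = _ := by ring
  have hbound : ∀ ξ, rho ξ ^ (2 * s - σ) * ∑' η, f η * g (ξ - η) ≤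
      2 ^ s * ((∑' η, (rho η ^ (-σ) * F η) * G (ξ - η)) +
        (∑' η, (rho η ^ (-σ) * G η) * F (ξ - η)) + rho ξ ^ (-σ) * ∑' η, F η * G (ξ - η)) := by
    intro ξ
    rw [tsum_mul_sub_comm (fun η => rho η ^ (-σ) * G η) F, ← tsum_mul_left, ← tsum_mul_left,
      ← (hX ξ).tsum_add (hY' ξ), ← ((hX ξ).add (hY' ξ)).tsum_add ((hZ ξ).mul_left _),
      ← tsum_mul_left]
    exact ((hsum ξ).mul_left _).tsum_le_tsum (hpt ξ)
      ((((hX ξ).add (hY' ξ)).add ((hZ ξ).mul_left _)).mul_left _)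
  have htot := ((hX2.add hY2).add
    (hw.mul_right ((∑' η, F η ^ 2) * ∑' η, G η ^ 2))).mul_left ((2 ^ s) ^ 2 * 3)
  refine Summable.of_nonneg_of_le (fun ξ => sq_nonneg _) (fun ξ => ?_) htot
  have h0 : 0 ≤ rho ξ ^ (2 * s - σ) * ∑' η, f η * g (ξ - η) :=
    mul_nonneg (hρ0 ξ _) (tsum_nonneg fun η => mul_nonneg (hf0 _) (hg0 _))
  refine (pow_le_pow_left₀ h0 (hbound ξ) 2).trans ?_
  rw [mul_pow, mul_assoc]
  refine mul_le_mul_of_nonneg_left ?_ (by positivity)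
  have h3 := mul_le_mul_of_nonneg_left (hZ2 ξ) (sq_nonneg (rho ξ ^ (-σ)))
  rw [← mul_pow] at h3
  set X := ∑' η, (rho η ^ (-σ) * F η) * G (ξ - η)
  set Y := ∑' η, (rho η ^ (-σ) * G η) * F (ξ - η)
  set Z := rho ξ ^ (-σ) * ∑' η, F η * G (ξ - η)
  -- This is `(X + Y + Z)² ≤ 3 (X² + Y² + Z²)`.
  nlinarith [sq_nonneg (X - Y), sq_nonneg (Y - Z), sq_nonneg (X - Z)]

/-! ### Fourier coefficients of the advection term -/

theorem sum_mul_fourierCoeff_eq_zero {u : Fin n → Distr n} (hu : divergence u = 0)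
    (ξ : Fin n → ℤ) : ∑ j, (ξ j : ℂ) * fourierCoeff (u j) ξ = 0 := by
  have h : fourierCoeff (divergence u) ξ = 0 := by rw [hu]; rfl
  rw [divergence, fourierCoeff_sum] at h
  simp only [fourierCoeff_distDeriv, mul_assoc, ← Finset.mul_sum] at h
  simpa [Real.pi_ne_zero] using h

theorem ofSmooth_expo_mul (η ζ ξ : Fin n → ℤ) :
    (ofSmooth (expo η * expo ζ)).1 (expo (-ξ)) = if ζ = ξ - η then 1 else 0 := by
  rw [← expo_add, ofSmooth_expo_expo]
  refine if_congr ?_ rfl rfl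
  rw [add_neg_eq_zero, eq_sub_iff_add_eq']

theorem ofSmooth_partialSum_mul (m : ℕ) (g h : Distr n) (j : Fin n) (ξ : Fin n → ℤ) :
    (ofSmooth (partialSum m g * smoothDeriv j (partialSum m h))).1 (expo (-ξ)) =
      ∑ η ∈ latticeBall n m, if ξ - η ∈ latticeBall n m then fourierCoeff g η *
        (fourierCoeff h (ξ - η) * (2 * Real.pi * Complex.I * ((ξ - η) j : ℤ))) else 0 := by
  simp only [partialSum, map_sum, map_smul, smoothDeriv_expo, Finset.sum_mul_sum, smul_mul_assoc,
    mul_smul_comm, smul_smul, Submodule.coe_sum, Submodule.coe_smul, LinearMap.sum_apply,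
    LinearMap.smul_apply, ofSmooth_expo_mul, smul_eq_mul, mul_ite, mul_one, mul_zero,
    Finset.sum_ite_eq']
  exact Finset.sum_congr rfl fun η _ => by rw [mul_comm (fourierCoeff g η)]

/-- The Fourier coefficients of the advection term of a divergence-free field are bounded by a
convolution. -/
theorem norm_fourierCoeff_advection_le {u B : Fin n → Distr n} (hu : divergence u = 0)
    (hB : IsAdvection u B) (k : Fin n) (ξ : Fin n → ℤ)
    (hs : ∀ j, Summable fun η => ‖fourierCoeff (u j) η‖ * ‖fourierCoeff (u k) (ξ - η)‖) :
    ‖fourierCoeff (B k) ξ‖ ≤ 2 * Real.pi * (rho ξ *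
      ∑ j, ∑' η, ‖fourierCoeff (u j) η‖ * ‖fourierCoeff (u k) (ξ - η)‖) := by
  have hpi := Real.pi_pos
  have hρ := rho_pos ξ
  -- The coefficient of each truncated product is bounded uniformly in m, and the bound passes to
  -- the limit tested on one exponential.
  refine le_of_tendsto (hB k (expo (-ξ))).norm (Filter.Eventually.of_forall fun m => ?_)
  have h1 : (ofSmooth (smoothAdvection (fun j => partialSum m (u j)) k)).1 (expo (-ξ)) =
      ∑ η ∈ latticeBall n m, if ξ - η ∈ latticeBall n m then (2 * Real.pi * Complex.I) *
        ((∑ j, (ξ j : ℂ) * fourierCoeff (u j) η) * fourierCoeff (u k) (ξ - η)) else 0 := by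
    rw [smoothAdvection, map_sum, Submodule.coe_sum, LinearMap.sum_apply]
    simp only [ofSmooth_partialSum_mul]
    rw [Finset.sum_comm]
    refine Finset.sum_congr rfl fun η _ => ?_
    split_ifs with h
    · have h0 := sum_mul_fourierCoeff_eq_zero hu η
      -- Since `η · û(η) = 0`, the frequency `ξ - η` from the derivative may be replaced by ξ, which
      -- no longer depends on the summation index.
      have h2 : ∑ j, (ξ j : ℂ) * fourierCoeff (u j) η =
          ∑ j, (((ξ - η) j : ℤ) : ℂ) * fourierCoeff (u j) η := by
        rw [← sub_zero (∑ j, (ξ j : ℂ) * fourierCoeff (u j) η), ← h0, ← Finset.sum_sub_distrib]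
        refine Finset.sum_congr rfl fun j _ => ?_
        rw [Pi.sub_apply]
        push_cast
        ring
      rw [h2, Finset.sum_mul, Finset.mul_sum]
      exact Finset.sum_congr rfl fun j _ => by ring
    · simp
  have hterm : ∀ η, ‖if ξ - η ∈ latticeBall n m then (2 * Real.pi * Complex.I) *
      ((∑ j, (ξ j : ℂ) * fourierCoeff (u j) η) * fourierCoeff (u k) (ξ - η)) else 0‖ ≤
      2 * Real.pi * (rho ξ * ∑ j, ‖fourierCoeff (u j) η‖ * ‖fourierCoeff (u k) (ξ - η)‖) := by
    intro η
    split_ifs with h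
    · have e0 : ‖(2 * Real.pi * Complex.I : ℂ)‖ = 2 * Real.pi := by simp [abs_of_pos hpi]
      rw [norm_mul, e0, norm_mul, ← Finset.sum_mul, ← mul_assoc (rho ξ)]
      refine mul_le_mul_of_nonneg_left (mul_le_mul_of_nonneg_right ?_ (norm_nonneg _))
        (by positivity)
      rw [Finset.mul_sum]
      refine norm_sum_le_of_le _ fun j _ => ?_
      rw [norm_mul, Complex.norm_intCast]
      exact mul_le_mul_of_nonneg_right (abs_le_rho ξ j) (norm_nonneg _)
    · rw [norm_zero]
      positivity
  rw [h1]
  refine (norm_sum_le_of_le _ fun η _ => hterm η).trans ?_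
  rw [← Finset.mul_sum, ← Finset.mul_sum, Finset.sum_comm]
  gcongr with j
  exact (hs j).sum_le_tsum _ fun η _ => by positivity

/-! ### Bootstrap and the smooth case -/

theorem mem_HSob_iff (g : Distr n) (s : ℝ) :
    g ∈ HSob n s ↔ WeightedL2 s fun ξ => ‖fourierCoeff g ξ‖ := Iff.rfl

theorem fourierCoeff_zero_eq (g : Distr n) : fourierCoeff g 0 = g.1 1 := by
  rw [fourierCoeff, neg_zero, expo_zero]

/-- One step of the regularity bootstrap. -/
theorem regularity_step {a : Fin n → Fin n → Fin n → Fin n → ℝ} (ha : IsSymmTensor a)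
    (hell : IsRelaxedElliptic a) {u : Fin n → Distr n} {p : Distr n} {f : Fin n → Distr n}
    (hsol : IsNavierStokesSolution a u p f) (hdiv : divergence u = 0)
    (hu0 : ∀ k, (u k).1 1 = 0) (hp0 : p.1 1 = 0) {s ε s₂ : ℝ} (hs : 0 < s) (hε : ε ≤ 1)
    (hn : (n : ℝ) < 2 * (s + 1 - ε)) (hu : ∀ k, u k ∈ HSob n s)
    (hf : ∀ k, f k ∈ HSob n (s₂ - 2)) :
    (∀ k, u k ∈ HSob n (min s₂ (s + ε))) ∧ p ∈ HSob n (min s₂ (s + ε) - 1) := by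
  obtain ⟨B, hB, heq⟩ := hsol
  obtain ⟨K, hK0, hK⟩ := exists_stokes_bound ha hell
  -- With `σ = s + 1 - ε` the products have order `2s - σ = s - 1 + ε`; the condition `ε ≤ 1` gives
  -- `s ≤ σ`.
  have hconv := fun j k => WeightedL2.convolution hs (σ := s + 1 - ε) (by linarith) hn
    (fun ξ => norm_nonneg (fourierCoeff (u j) ξ)) (fun ξ => norm_nonneg (fourierCoeff (u k) ξ))
    (hu j) (hu k)
  set s' := min s₂ (s + ε) with hs'
  -- The factor ρ(ξ) costs one derivative, which leaves order `s - 2 + ε ≥ s' - 2`.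
  have hBk : ∀ k, WeightedL2 (s' - 2) fun ξ => ‖fourierCoeff (B k) ξ‖ := fun k => by
    have h1 := (WeightedL2.sum Finset.univ fun j _ => (hconv j k).2).rho_mul 1
    have h2 := (h1.const_mul (2 * Real.pi)).mono_weight (t := s' - 2) (by
      have := min_le_right s₂ (s + ε)
      linarith)
    refine h2.mono (fun ξ => norm_nonneg _) fun ξ => ?_
    rw [Real.rpow_one]
    exact norm_fourierCoeff_advection_le hdiv hB k ξ fun j => (hconv j k).1 ξ
  have hfk : ∀ k, WeightedL2 (s' - 2) fun ξ => ‖fourierCoeff (f k) ξ‖ := fun k =>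
    WeightedL2.mono_weight (hf k) (by have := min_le_left s₂ (s + ε); linarith)
  have hG : WeightedL2 (s' - 2) fun ξ => K * ∑ k, ‖fourierCoeff (f k) ξ - fourierCoeff (B k) ξ‖ := by
    refine WeightedL2.const_mul (WeightedL2.sum _ fun k _ => ?_) K
    exact ((hfk k).add (hBk k)).mono (fun ξ => norm_nonneg _) fun ξ => norm_sub_le _ _
  have hbound : ∀ ξ : Fin n → ℤ, ξ ≠ 0 →
      rho ξ ^ 2 * ∑ k, ‖fourierCoeff (u k) ξ‖ ≤
        K * ∑ k, ‖fourierCoeff (f k) ξ - fourierCoeff (B k) ξ‖ ∧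
      rho ξ * ‖fourierCoeff p ξ‖ ≤
        K * ∑ k, ‖fourierCoeff (f k) ξ - fourierCoeff (B k) ξ‖ := fun ξ hξ => by
    refine hK ξ hξ _ _ _ (sum_mul_fourierCoeff_eq_zero hdiv ξ) fun k => ?_
    have h := congrArg (fun g => fourierCoeff g ξ) (heq k)
    simp only [fourierCoeff_add, fourierCoeff_neg, fourierCoeff_viscousOp ha,
      fourierCoeff_distDeriv] at h
    rw [← h]
    ring
  constructor
  · intro k
    have h := (hG.rho_mul (-2)).mono (f := fun ξ => ‖fourierCoeff (u k) ξ‖)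
      (fun ξ => norm_nonneg _) fun ξ => ?_
    · rw [mem_HSob_iff]
      convert h using 1
      ring
    · have hρ := rho_pos ξ
      -- The Stokes bound gives nothing at frequency 0; there the zero mean is used.
      by_cases hξ : ξ = 0
      · subst hξ
        rw [fourierCoeff_zero_eq, hu0, norm_zero]
        positivity
      · rw [Real.rpow_neg hρ.le, Real.rpow_two, inv_mul_eq_div, le_div_iff₀' (by positivity)]
        refine le_trans ?_ (hbound ξ hξ).1
        gcongr
        exact Finset.single_le_sum (f := fun k => ‖fourierCoeff (u k) ξ‖)
          (fun _ _ => norm_nonneg _) (Finset.mem_univ k)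
  · have h := (hG.rho_mul (-1)).mono (f := fun ξ => ‖fourierCoeff p ξ‖)
      (fun ξ => norm_nonneg _) fun ξ => ?_
    · rw [mem_HSob_iff]
      convert h using 1
      ring
    · have hρ := rho_pos ξ
      by_cases hξ : ξ = 0
      · subst hξ
        rw [fourierCoeff_zero_eq, hp0, norm_zero]
        positivity
      · rw [Real.rpow_neg hρ.le, Real.rpow_one, inv_mul_eq_div, le_div_iff₀' hρ]
        exact (hbound ξ hξ).2

theorem HSob_anti {s t : ℝ} (h : t ≤ s) : HSob n s ⊆ HSob n t := fun g hg =>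
  WeightedL2.mono_weight (f := fun ξ => ‖fourierCoeff g ξ‖) hg h

/-- Sobolev regularity of solutions of the stationary Navier–Stokes system. -/
theorem regularity {a : Fin n → Fin n → Fin n → Fin n → ℝ} (ha : IsSymmTensor a)
    (hell : IsRelaxedElliptic a) {u : Fin n → Distr n} {p : Distr n} {f : Fin n → Distr n}
    (hsol : IsNavierStokesSolution a u p f) (hdiv : divergence u = 0)
    (hu0 : ∀ k, (u k).1 1 = 0) (hp0 : p.1 1 = 0) {s₁ s₂ : ℝ} (hs₁ : 0 < s₁)
    (hn : -1 + (n : ℝ) / 2 < s₁) (h12 : s₁ < s₂) (hu : ∀ k, u k ∈ HSob n s₁)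
    (hf : ∀ k, f k ∈ HSob n (s₂ - 2)) :
    (∀ k, u k ∈ HSob n s₂) ∧ p ∈ HSob n (s₂ - 1) := by
  obtain ⟨ε, hε0, hε1, hε⟩ : ∃ ε : ℝ, 0 < ε ∧ ε ≤ 1 ∧ (n : ℝ) < 2 * (s₁ + 1 - ε) := by
    -- Half of the gap `s₁ + 1 - n/2` is spent on ε and the other half keeps the inequality strict;
    -- larger s only improves it.
    refine ⟨min 1 ((s₁ + 1 - n / 2) / 2), lt_min one_pos (by linarith), min_le_left _ _, ?_⟩
    have := min_le_right 1 ((s₁ + 1 - n / 2) / 2)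
    linarith
  have step : ∀ s, s₁ ≤ s → (∀ k, u k ∈ HSob n s) → _ := fun s hs hus =>
    regularity_step ha hell hsol hdiv hu0 hp0 (s := s) (ε := ε) (s₂ := s₂) (by linarith) hε1
      (by linarith) hus hf
  have hN : ∀ N : ℕ, ∀ k, u k ∈ HSob n (min s₂ (s₁ + N * ε)) := by
    intro N
    induction N with
    | zero => simpa [h12.le] using hu
    | succ N ih =>
      have hNε : 0 ≤ N * ε := by positivity
      intro k
      refine HSob_anti ?_ ((step _ (le_min h12.le (by linarith)) ih).1 k)
      push_cast
      refine le_min (min_le_left _ _) ?_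
      rw [← min_add_add_right]
      exact le_min ((min_le_left _ _).trans (by linarith))
        ((min_le_right _ _).trans (by linarith))
  obtain ⟨N, hNs⟩ := exists_nat_gt ((s₂ - s₁) / ε)
  rw [div_lt_iff₀ hε0] at hNs
  have hus := hN N
  rw [min_eq_left (by linarith)] at hus
  -- The induction has recorded only the velocity; one more step at `s₂` yields the pressure.
  have := step s₂ h12.le hus
  rwa [min_eq_left (by linarith)] at this

/-- The weighted coefficients are both bounded and summable, hence square summable. -/
theorem ofSmooth_mem_HSob (φ : CInf n) (s : ℝ) : ofSmooth φ ∈ HSob n s := by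
  obtain ⟨N, hN⟩ := exists_nat_ge s
  obtain ⟨C, hC⟩ := exists_rho_pow_mul_fourierCoeff_le φ N
  have h := (rapidDecay_fourierCoeff_ofSmooth φ N).mul_left C
  refine HSob_anti hN ?_
  rw [mem_HSob_iff, weightedL2_iff]
  refine Summable.of_nonneg_of_le (fun ξ => sq_nonneg _) (fun ξ => ?_) h
  have hρ := rho_pos ξ
  rw [Real.rpow_natCast, sq]
  exact mul_le_mul_of_nonneg_right (hC ξ) (by positivity)

theorem rapidDecay_of_mem_HSob {g : Distr n} (h : ∀ s, ∃ t, s ≤ t ∧ g ∈ HSob n t) :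
    RapidDecay (fourierCoeff g) := by
  refine rapidDecay_of_bounded fun N => ?_
  obtain ⟨t, ht, hg⟩ := h N
  have hs := HSob_anti ht hg
  rw [mem_HSob_iff, weightedL2_iff] at hs
  refine ⟨1 + ∑' ξ, (rho ξ ^ (N : ℝ) * ‖fourierCoeff g ξ‖) ^ 2, fun ξ => ?_⟩
  have h1 := hs.le_tsum ξ fun _ _ => sq_nonneg _
  rw [← Real.rpow_natCast]
  -- Uses `t ≤ 1 + t²` to pass from the square to the term itself.
  nlinarith [sq_nonneg (rho ξ ^ (N : ℝ) * ‖fourierCoeff g ξ‖ - 1)]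

end TorusNS

end

theorem mainTheorem5 (n : ℕ) (hn : 2 ≤ n)
    (a : Fin n → Fin n → Fin n → Fin n → ℝ)
    (ha_symm : TorusNS.IsSymmTensor a) (ha_ell : TorusNS.IsRelaxedElliptic a)
    (s₁ : ℝ) (hs₁ : -1 + (n : ℝ) / 2 < s₁)
    (u : Fin n → TorusNS.Distr n) (p : TorusNS.Distr n) (f : Fin n → TorusNS.Distr n)
    (hu : u ∈ TorusNS.HDotSigma n s₁) (hp : p ∈ TorusNS.HDot n (s₁ - 1))
    (hsol : TorusNS.IsNavierStokesSolution a u p f) :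
    (∀ s₂ : ℝ, s₁ < s₂ → (∀ k, f k ∈ TorusNS.HDot n (s₂ - 2)) →
      u ∈ TorusNS.HDotSigma n s₂ ∧ p ∈ TorusNS.HDot n (s₂ - 1)) ∧
    ((∀ k, f k ∈ TorusNS.CInfDot n) →
      (∀ k, u k ∈ TorusNS.CInfDot n) ∧ p ∈ TorusNS.CInfDot n) := by
  -- The dimension bound `n ≥ 2` enters here: it makes `s₁` positive, as the convolution estimate
  -- requires.
  have hs₁0 : 0 < s₁ := by
    have : (2 : ℝ) ≤ n := by exact_mod_cast hn
    linarith
  have key : ∀ s₂ : ℝ, s₁ < s₂ → (∀ k, f k ∈ TorusNS.HSob n (s₂ - 2)) →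
      (∀ k, u k ∈ TorusNS.HSob n s₂) ∧ p ∈ TorusNS.HSob n (s₂ - 1) := fun s₂ h12 hf =>
    TorusNS.regularity ha_symm ha_ell hsol hu.2 (fun k => (hu.1 k).2) hp.2 hs₁0 hs₁ h12
      (fun k => (hu.1 k).1) hf
  refine ⟨fun s₂ h12 hf => ?_, fun hf => ?_⟩
  · obtain ⟨h1, h2⟩ := key s₂ h12 fun k => (hf k).1
    exact ⟨⟨fun k => ⟨h1 k, (hu.1 k).2⟩, hu.2⟩, h2, hp.2⟩
  · have hall : ∀ s₂ : ℝ, s₁ < s₂ →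
        (∀ k, u k ∈ TorusNS.HSob n s₂) ∧ p ∈ TorusNS.HSob n (s₂ - 1) := fun s₂ h12 =>
      key s₂ h12 fun k => by
        obtain ⟨φ, hφ⟩ := (hf k).1
        rw [hφ]
        exact TorusNS.ofSmooth_mem_HSob φ _
    -- The added 1 compensates for the pressure being one order less regular than the velocity.
    have hlt : ∀ s : ℝ, s₁ < max s s₁ + 1 := fun s => by
      have := le_max_right s s₁
      linarith
    have hle : ∀ s : ℝ, s ≤ max s s₁ := fun s => le_max_left _ _
    refine ⟨fun k => ⟨⟨_, TorusNS.eq_ofSmooth_of_rapidDecay (u k)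
      (TorusNS.rapidDecay_of_mem_HSob fun s => ?_)⟩, (hu.1 k).2⟩,
      ⟨_, TorusNS.eq_ofSmooth_of_rapidDecay p (TorusNS.rapidDecay_of_mem_HSob fun s => ?_)⟩, hp.2⟩
    · exact ⟨_, (hle s).trans (by linarith), (hall _ (hlt s)).1 k⟩
    · exact ⟨_, (hle s).trans (by linarith), (hall _ (hlt s)).2⟩
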